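/- Let $\mathbb F_q$ be a finite field, $A=\mathbb F_q[T]$, let $\varpi\in A$ be a monic irreducible polynomial, $\mathfrak p=(\varpi)$, let $A_{\mathfrak p}$ be the $\mathfrak p$-adic completion of $A$ and $\kappa(\mathfrak p)=A_{\mathfrak p}/\mathfrak p$ its residue field. Put \[ \Lambda=A_{\mathfrak p}\llbracket A_{\mathfrak p}^\times\rrbracket=\varprojlim_m (A_{\mathfrak p}/\mathfrak p^m)\bigl[A_{\mathfrak p}^\times/(1+\mathfrak p^m)\bigr],\qquad \Lambda_0=A_{\mathfrak p}\llbracket 1+\mathfrak p\rrbracket=\varprojlim_m (A_{\mathfrak p}/\mathfrak p^m)\bigl[(1+\mathfrak p)/(1+\mathfrak p^m)\bigr] \] with the inverse limit topologies (every term of the limits is discrete), write $[g]$ for the element of such an algebra defined by a group element $g$, and let $(\kappa(\mathfrak p)^\times)^*=\operatorname{Hom}(\kappa(\mathfrak p)^\times,A_{\mathfrak p}^\times)$. Then: (1) $\Lambda$ is a profinite ring with finitely many maximal ideals. (2) $\Lambda_0$ is a profinite local ring, and the reduction $\Lambda_0\to(A_{\mathfrak p}/\mathfrak p)[(1+\mathfrak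 p)/(1+\mathfrak p)]=\kappa(\mathfrak p)$ is surjective with kernel the maximal ideal. There is an isomorphism of topological $A_{\mathfrak p}$-algebras $\Lambda_0\cong A_{\mathfrak p}\llbracket T_1,T_2,\dots\rrbracket$ onto the ring of all formal power series in countably infinitely many variables (every monomial involving only finitely many of them), with the topology of coefficientwise $\mathfrak p$-adic convergence. (3) There is an isomorphism of topological $A_{\mathfrak p}$-algebras \[ \Lambda\;\cong\prod_{\chi\in(\kappa(\mathfrak p)^\times)^*}\Lambda_0 \] which sends $[\zeta v]$ to $(\chi(\zeta \bmod \mathfrak p)\,[v])_\chi$ for all $v\in 1+\mathfrak p$ and all $\zeta\in A_{\mathfrak p}^\times$ with $\zeta^{\#\kappa(\mathfrak p)^\times}=1$. (4) Let $\pi\colon\Lambda\to\prod_{\chi}\kappa(\mathfrak p)$ be the composite of the isomorphism in (3) with the reduction $\Lambda_0\to\kappa(\mathfrak p)$ in every component. There is a decreasing sequence of ideals $\ker\pi=I_0\supseteq I_1\supseteq I_2\supseteq\cdots$ of $\Lambda$, with $\Lambda/I_r$ finite for all $r$, which is a basis of neighbourhoods of $0$ in $\Lambda$, such that for every $r\ge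 0$ the action of $\Lambda$ on $I_r/I_{r+1}$ factors through $\pi$. -/

import Mathlib

open Polynomial

noncomputable section

namespace Iwasawa

/-! ### The Iwasawa algebra `R⟦G⟧ = lim_m (R/I^m)[G/N_m]` -/

section General

variable {R : Type*} [CommRing R] (I : Ideal R)
variable {G : Type*} [CommGroup G] (N : ℕ →o (Subgroup G)ᵒᵈ)

/-- The `m`-th subgroup of a decreasing sequence `N` of subgroups of `G`. -/
abbrev sub (m : ℕ) : Subgroup G := OrderDual.ofDual (N m)

/-- The `m`-th level `(R/I^m)[G/N_m]`. -/
abbrev Level (m : ℕ) : Type _ := MonoidAlgebra (R ⧸ I ^ m) (G ⧸ sub N m)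

/-- The projection `G/N_{m+1} → G/N_m`. -/
def quotTransition (m : ℕ) : G ⧸ sub N (m + 1) →* G ⧸ sub N m :=
  QuotientGroup.map (sub N (m + 1)) (sub N m) (MonoidHom.id G) (N.monotone (Nat.le_succ m))

/-- The transition map `(R/I^{m+1})[G/N_{m+1}] → (R/I^m)[G/N_m]`. -/
def transition (m : ℕ) : Level I N (m + 1) →ₐ[R] Level I N m :=
  (MonoidAlgebra.mapDomainAlgHom R (R ⧸ I ^ m) (quotTransition N m)).comp
    (MonoidAlgebra.mapAlgHom (G ⧸ sub N (m + 1))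
      (Ideal.Quotient.factorₐ R (Ideal.pow_le_pow_right (Nat.le_succ m))))

/-- `lim_m (R/I^m)[G/N_m]`, realised as the `R`-algebra of compatible families. -/
def iwasawaSubalgebra : Subalgebra R (∀ m, Level I N m) where
  carrier := {x | ∀ m, transition I N m (x (m + 1)) = x m}
  mul_mem' hx hy m := by simp only [Pi.mul_apply, map_mul, hx m, hy m]
  add_mem' hx hy m := by simp only [Pi.add_apply, map_add, hx m, hy m]
  algebraMap_mem' r m := by simp only [Pi.algebraMap_apply, AlgHom.commutes]

/-- The Iwasawa algebra `R⟦G⟧ = lim_m (R/I^m)[G/N_m]`. -/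
abbrev Alg : Type _ := iwasawaSubalgebra I N

/-- The projection of the Iwasawa algebra to its `m`-th level. -/
def proj (m : ℕ) : Alg I N →ₐ[R] Level I N m :=
  (Pi.evalAlgHom R (Level I N) m).comp (iwasawaSubalgebra I N).val

/-- The inverse limit topology, every level being discrete. -/
instance : TopologicalSpace (Alg I N) := ⨅ m, TopologicalSpace.induced (proj I N m) ⊥

/-- The group-like element `[g]` of the Iwasawa algebra. -/
def of (g : G) : Alg I N :=
  ⟨fun m => MonoidAlgebra.single (QuotientGroup.mk g : G ⧸ sub N m) 1, fun m => by
    simp only [transition, AlgHom.comp_apply, MonoidAlgebra.mapAlgHom_single, map_one]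
    exact MonoidAlgebra.mapDomain_single⟩

/-- The reduction `R⟦G⟧ → R/I`: project to `(R/I)[G/N_1]` and apply the augmentation. -/
def residue : Alg I N →ₐ[R] R ⧸ I :=
  (((MonoidAlgebra.lift (R ⧸ I) (R ⧸ I) (G ⧸ sub N 1) 1).restrictScalars R).comp
    (MonoidAlgebra.mapAlgHom (G ⧸ sub N 1)
      (Ideal.Quotient.factorₐ R (le_of_eq (pow_one I))))).comp (proj I N 1)

/-- The group `1 + I^m` of units of `R` congruent to `1` modulo `I^m`. -/
def oneAdd (m : ℕ) : Subgroup Rˣ :=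
  (Units.map (Ideal.Quotient.mk (I ^ m) : R →* R ⧸ I ^ m)).ker

theorem oneAdd_anti {a b : ℕ} (hab : a ≤ b) : oneAdd I b ≤ oneAdd I a := by
  intro u hu
  simp only [oneAdd, MonoidHom.mem_ker, Units.ext_iff, Units.coe_map, Units.val_one,
    MonoidHom.coe_coe] at hu ⊢
  rw [← map_one (Ideal.Quotient.mk _), Ideal.Quotient.eq] at hu ⊢
  exact Ideal.pow_le_pow_right hab hu

/-- The decreasing sequence `m ↦ 1 + I^m` of subgroups of `Rˣ`. -/
def unitFiltration : ℕ →o (Subgroup Rˣ)ᵒᵈ where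
  toFun m := OrderDual.toDual (oneAdd I m)
  monotone' _ _ hab := oneAdd_anti I hab

/-- The decreasing sequence `m ↦ (1 + I) ∩ (1 + I^m)` of subgroups of `1 + I`. -/
def oneUnitFiltration : ℕ →o (Subgroup (oneAdd I 1))ᵒᵈ where
  toFun m := OrderDual.toDual ((oneAdd I m).subgroupOf (oneAdd I 1))
  monotone' _ _ hab := fun _ hu => oneAdd_anti I hab hu

end General

/-! ### The case of `A_𝔭`, for `A = F[T]` and `𝔭 = (ϖ)` -/

section Completion

variable {F : Type*} [Field F] (ϖ : F[X])

/-- `A_𝔭`, the `𝔭`-adic completion of `A = F[T]` for `𝔭 = (ϖ)`. -/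
abbrev Ap : Type _ := AdicCompletion (Ideal.span {ϖ}) F[X]

/-- The ideal `𝔭 A_𝔭` of `A_𝔭`. -/
def pp : Ideal (Ap ϖ) := (Ideal.span {ϖ}).map (algebraMap F[X] (Ap ϖ))

/-- The `𝔭`-adic topology of `A_𝔭`. -/
instance : TopologicalSpace (Ap ϖ) := (pp ϖ).adicTopology

/-- The residue field `κ(𝔭) = A_𝔭/𝔭`. -/
abbrev Kappa : Type _ := Ap ϖ ⧸ pp ϖ

/-- Reduction of units `A_𝔭ˣ → κ(𝔭)ˣ`. -/
def unitReduction : (Ap ϖ)ˣ →* (Kappa ϖ)ˣ :=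
  Units.map (Ideal.Quotient.mk (pp ϖ) : Ap ϖ →* Kappa ϖ)

/-- The characters of `κ(𝔭)ˣ`, with values in `A_𝔭ˣ`. -/
abbrev Chars : Type _ := (Kappa ϖ)ˣ →* (Ap ϖ)ˣ

/-- `Λ = A_𝔭⟦A_𝔭ˣ⟧ = lim_m (A_𝔭/𝔭^m)[A_𝔭ˣ/(1+𝔭^m)]`. -/
abbrev Lam : Type _ := Alg (pp ϖ) (unitFiltration (pp ϖ))

/-- The group `1 + 𝔭`. -/
abbrev OneUnits : Type _ := oneAdd (pp ϖ) 1

/-- `Λ₀ = A_𝔭⟦1+𝔭⟧ = lim_m (A_𝔭/𝔭^m)[(1+𝔭)/(1+𝔭^m)]`. -/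
abbrev Lam0 : Type _ := Alg (pp ϖ) (oneUnitFiltration (pp ϖ))

/-- The group-like element `[u]` of `Λ`. -/
abbrev ofUnit (u : (Ap ϖ)ˣ) : Lam ϖ := of (pp ϖ) (unitFiltration (pp ϖ)) u

/-- The group-like element `[v]` of `Λ₀`. -/
abbrev ofOneUnit (v : OneUnits ϖ) : Lam0 ϖ := of (pp ϖ) (oneUnitFiltration (pp ϖ)) v

/-- The reduction `Λ₀ → κ(𝔭)`. -/
abbrev residue0 : Lam0 ϖ →ₐ[Ap ϖ] Kappa ϖ := residue (pp ϖ) (oneUnitFiltration (pp ϖ))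

/-- The ring homomorphism `Λ → ∏_χ κ(𝔭)` obtained from a decomposition `Λ ≅ ∏_χ Λ₀` by reducing
every component. -/
def residueProd (e : Lam ϖ ≃ₐ[Ap ϖ] (Chars ϖ → Lam0 ϖ)) : Lam ϖ →+* (Chars ϖ → Kappa ϖ) :=
  RingHom.pi fun χ =>
    ((residue0 ϖ : Lam0 ϖ →+* Kappa ϖ).comp (Pi.evalRingHom (fun _ : Chars ϖ => Lam0 ϖ) χ)).comp
      (e : Lam ϖ →+* (Chars ϖ → Lam0 ϖ))

end Completion

/-- The action of `S` on the module `M` factors through the ring homomorphism `π : S → B`. -/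
def ActsThrough {S B : Type*} [CommRing S] [CommRing B] (π : S →+* B)
    (M : Type*) [AddCommGroup M] [Module S M] : Prop :=
  ∃ ρ : B →+* Module.End S M, ∀ (x : S) (v : M), ρ (π x) v = x • v

/-- The action of `S` on the subquotient `J/J'` (for ideals `J' ≤ J`) factors through
`π : S → B`. -/
def QuotActsThrough {S B : Type*} [CommRing S] [CommRing B] (π : S →+* B) (J J' : Ideal S) : Prop :=
  ActsThrough π (J ⧸ J'.submoduleOf J)

/-- A profinite ring: a topological ring that is compact, Hausdorff and totally disconnected. -/
structure IsProfiniteRing (S : Type*) [CommRing S] [TopologicalSpace S] : Prop where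
  isTopologicalRing : IsTopologicalRing S
  compactSpace : CompactSpace S
  t2Space : T2Space S
  totallyDisconnectedSpace : TotallyDisconnectedSpace S

end Iwasawa

end

/-!
The group of one-units of `A_𝔭` is a product of countably many copies of `ℤ_p`, topologically
generated by the elements `1 + a t ^ n` with `t` a generator of `𝔭`, `p ∤ n` and `a` running
through lifts of an `𝔽_p`-basis of the residue field: in characteristic `p` the `p ^ k`-th power
of `1 + a t ^ n` is `1 + a ^ (p ^ k) t ^ (n p ^ k)`, so that products of powers of these elements
reach every leading coefficient. Also `(u - 1) ^ (p ^ k) = u ^ (p ^ k) - 1`, so power series can be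
evaluated at the elements `[u] - 1` with `u` one of the generators. Evaluation is surjective onto
each term of the limit because the `u` generate. It is injective by counting: modulo `𝔭 ^ m` the
generator with exponent `n` has order at most the least `p ^ k` with `n p ^ k ≥ m`, and the product
of these bounds does not exceed the order of `(1 + 𝔭) / (1 + 𝔭 ^ m)`; hence the series with value
`0` at level `m` are those whose coefficients of degrees below these bounds lie in `𝔭 ^ m`.

The Teichmüller character splits the reduction `A_𝔭ˣ → κ(𝔭)ˣ`. As the order of `κ(𝔭)ˣ` is a
unit, the idempotents attached to its characters make the character projections jointly surjective
at each level, and a comparison of cardinalities makes them jointly bijective.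

Finally `M = ker π` lies in the Jacobson radical of `Λ`, so it is nilpotent modulo each of the
ideals `J_m` defining the topology. The powers of `M` need not be open, but the ideals
`I_r = ⋂_m (M ^ (1 + max (r - m, 0)) + M ∩ J_m)` are, and `M I_r ⊆ I_{r + 1}`.
-/

noncomputable section

namespace Iwasawa

open Topology

section General

variable {R : Type*} [CommRing R] (I : Ideal R)
variable {G : Type*} [CommGroup G] (N : ℕ →o (Subgroup G)ᵒᵈ)

theorem transition_single_one (m : ℕ) (g : G) :
    transition I N m (MonoidAlgebra.single (QuotientGroup.mk g) 1) =
    MonoidAlgebra.single (QuotientGroup.mk g) 1 := by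
  simp only [transition, AlgHom.comp_apply, MonoidAlgebra.mapAlgHom_single, map_one]
  exact MonoidAlgebra.mapDomain_single

theorem transition_proj (m : ℕ) (x : Alg I N) :
    transition I N m (proj I N (m + 1) x) = proj I N m x := x.2 m

theorem proj_of (m : ℕ) (g : G) :
    proj I N m (of I N g) = MonoidAlgebra.single (QuotientGroup.mk g : G ⧸ sub N m) 1 := rfl

variable {I N} in
@[ext]
theorem alg_ext {x y : Alg I N} (h : ∀ m, proj I N m x = proj I N m y) : x = y :=
  Subtype.ext (funext h)

/-- The map to the limit defined by a compatible family of algebra homomorphisms. -/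
def limLift {B : Type*} [CommRing B] [Algebra R B] (h : ∀ m, B →ₐ[R] Level I N m)
    (hc : ∀ m b, transition I N m (h (m + 1) b) = h m b) : B →ₐ[R] Alg I N :=
  (AlgHom.pi h).codRestrict (iwasawaSubalgebra I N) fun b m => hc m b

@[simp]
theorem proj_limLift {B : Type*} [CommRing B] [Algebra R B] (h : ∀ m, B →ₐ[R] Level I N m)
    (hc : ∀ m b, transition I N m (h (m + 1) b) = h m b) (m : ℕ) (b : B) :
    proj I N m (limLift I N h hc b) = h m b := rfl

theorem ker_proj_antitone : Antitone fun m => RingHom.ker (proj I N m) :=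
  antitone_nat_of_succ_le fun m x hx => by
    rw [RingHom.mem_ker] at hx ⊢
    rw [← transition_proj, hx, map_zero]

theorem ker_proj_le_ker_residue : RingHom.ker (proj I N 1) ≤ RingHom.ker (residue I N) := by
  intro x hx
  rw [RingHom.mem_ker] at hx ⊢
  rw [residue, AlgHom.comp_apply, hx, map_zero]

theorem residue_surjective : Function.Surjective (residue I N) := fun x => by
  obtain ⟨r, rfl⟩ := Ideal.Quotient.mk_surjective x
  exact ⟨algebraMap R _ r, (residue I N).commutes r⟩

theorem ker_residue_isMaximal [I.IsMaximal] : (RingHom.ker (residue I N)).IsMaximal :=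
  let _ := Ideal.Quotient.field I
  RingHom.ker_isMaximal_of_surjective _ (residue_surjective I N)

theorem nhds_zero_hasBasis :
    (𝓝 (0 : Alg I N)).HasBasis (fun _ : ℕ => True)
      (fun m => (RingHom.ker (proj I N m) : Set (Alg I N))) := by
  have h : 𝓝 (0 : Alg I N) =
      ⨅ m, Filter.principal (RingHom.ker (proj I N m) : Set (Alg I N)) := by
    refine nhds_iInf.trans (iInf_congr fun m => ?_)
    let _ : TopologicalSpace (Level I N m) := ⊥
    have : DiscreteTopology (Level I N m) := ⟨rfl⟩
    rw [nhds_induced, nhds_discrete, ← Filter.principal_singleton, Filter.comap_principal, map_zero]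
    rfl
  rw [h]
  exact Filter.hasBasis_iInf_principal (ker_proj_antitone I N).directed_ge

section Profinite

local instance (m : ℕ) : TopologicalSpace (Level I N m) := ⊥

local instance (m : ℕ) : DiscreteTopology (Level I N m) := ⟨rfl⟩

theorem isClosedEmbedding_proj :
    IsClosedEmbedding fun (x : Alg I N) m => proj I N m x := by
  refine ⟨⟨inducing_iInf_to_pi fun m => proj I N m, fun x y h => alg_ext (congrFun h)⟩, ?_⟩
  have hrange : Set.range (fun (x : Alg I N) m => proj I N m x) =
      ⋂ m, {y : ∀ m, Level I N m | transition I N m (y (m + 1)) = y m} := by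
    ext y
    rw [Set.mem_iInter]
    exact ⟨by rintro ⟨x, rfl⟩; exact x.2, fun h => ⟨⟨y, h⟩, rfl⟩⟩
  rw [hrange]
  exact isClosed_iInter fun m => isClosed_eq
    (continuous_of_discreteTopology.comp (continuous_apply (m + 1))) (continuous_apply m)

theorem continuous_proj (m : ℕ) : Continuous (proj I N m) :=
  (continuous_apply m).comp (isClosedEmbedding_proj I N).continuous

theorem isClosed_ker_proj (m : ℕ) : IsClosed (RingHom.ker (proj I N m) : Set (Alg I N)) :=
  isClosed_singleton.preimage (continuous_proj I N m)

instance : T2Space (Alg I N) := (isClosedEmbedding_proj I N).isEmbedding.t2Space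

instance : IsTopologicalRing (Alg I N) :=
  have hi := (isClosedEmbedding_proj I N).isInducing
  { continuous_add := hi.continuous_iff.2 <| continuous_pi fun m =>
      ((continuous_proj I N m).comp continuous_fst).add
        ((continuous_proj I N m).comp continuous_snd)
    continuous_mul := hi.continuous_iff.2 <| continuous_pi fun m =>
      ((continuous_proj I N m).comp continuous_fst).mul
        ((continuous_proj I N m).comp continuous_snd)
    continuous_neg := hi.continuous_iff.2 <| continuous_pi fun m => (continuous_proj I N m).neg }

instance finite_level [∀ m, Finite (R ⧸ I ^ m)] [∀ m, Finite (G ⧸ sub N m)] (m : ℕ) :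
    Finite (Level I N m) :=
  Finite.of_equiv _ (MonoidAlgebra.coeffEquiv.trans Finsupp.equivFunOnFinite).symm

theorem alg_isProfiniteRing [∀ m, Finite (R ⧸ I ^ m)] [∀ m, Finite (G ⧸ sub N m)] :
    IsProfiniteRing (Alg I N) where
  isTopologicalRing := inferInstance
  compactSpace := (isClosedEmbedding_proj I N).compactSpace
  t2Space := inferInstance
  totallyDisconnectedSpace := (isClosedEmbedding_proj I N).isEmbedding.isTotallyDisconnected_range.1
    (isTotallyDisconnected_of_totallyDisconnectedSpace _)

end Profinite

variable {I N}

theorem continuous_of_preimage_ker_proj_mem_nhds {B : Type*} [Ring B] [TopologicalSpace B]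
    [IsTopologicalAddGroup B] (f : B →+* Alg I N)
    (hf : ∀ m, {b | proj I N m (f b) = 0} ∈ 𝓝 0) : Continuous f := by
  refine continuous_of_continuousAt_zero f ?_
  rw [ContinuousAt, map_zero, (nhds_zero_hasBasis I N).tendsto_right_iff]
  exact fun m _ => hf m

theorem surjective_of_surjective_proj {X : Type*} [TopologicalSpace X] [CompactSpace X]
    {f : X → Alg I N} (hf : Continuous f)
    (hsurj : ∀ m, Function.Surjective fun x => proj I N m (f x)) : Function.Surjective f := by
  rw [← Set.range_eq_univ, ← (isCompact_range hf).isClosed.closure_eq, Set.eq_univ_iff_forall]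
  intro y
  have hbasis := (nhds_zero_hasBasis I N).map (y + ·)
  rw [map_add_left_nhds_zero] at hbasis
  refine (mem_closure_iff_nhds_basis hbasis).2 fun m _ => ?_
  obtain ⟨x, hx : proj I N m (f x) = _⟩ := hsurj m (proj I N m y)
  refine ⟨f x, ⟨x, rfl⟩, f x - y, ?_, add_sub_cancel y (f x)⟩
  rw [SetLike.mem_coe, RingHom.mem_ker, map_sub, hx, sub_self]

end General

section Generation

theorem factorsThrough_of_card_le {A B C : Type*} [Finite B] [Nonempty C] {φ : A → B} {ψ : A → C}
    (hψ : Function.Surjective ψ) (h : ψ.FactorsThrough φ) (hcard : Nat.card B ≤ Nat.card C) :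
    φ.FactorsThrough ψ := by
  obtain ⟨L, rfl⟩ := (Function.factorsThrough_iff ψ).1 h
  exact fun _ _ hab => (hψ.of_comp.bijective_of_nat_card_le hcard).1 hab

theorem sub_one_pow_char_pow (R : Type*) {B : Type*} [CommRing R] [CommRing B] [Algebra R B] (p : ℕ)
    [Fact p.Prime] [CharP R p] (x : B) (k : ℕ) : (x - 1) ^ p ^ k = x ^ p ^ k - 1 := by
  simpa using congrArg (Polynomial.aeval x) (sub_pow_char_pow (Polynomial.X : Polynomial R) 1 k)

theorem charP_quotient {R : Type*} [CommRing R] (I : Ideal R) [Nontrivial (R ⧸ I)] (p : ℕ)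
    [Fact p.Prime] [CharP R p] : CharP (R ⧸ I) p :=
  (CharP.charP_iff_prime_eq_zero Fact.out).2 <| by
    rw [← map_natCast (Ideal.Quotient.mk I), CharP.cast_eq_zero, map_zero]

theorem surjective_monoidAlgebra_of_closure_eq_top {R B S Q : Type*} [CommRing R] [CommRing B]
    [Algebra R B] [CommRing S] [Algebra R S] [Group Q] [Finite Q]
    (hS : Function.Surjective (algebraMap R S)) (φ : B →ₐ[R] MonoidAlgebra S Q) {s : Set Q}
    (hs : Subgroup.closure s = ⊤) (h : ∀ g ∈ s, MonoidAlgebra.single g 1 ∈ φ.range) :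
    Function.Surjective φ := by
  have hclosure : Submonoid.closure s ≤
      (MonoidHom.mrange (φ : B →* MonoidAlgebra S Q)).comap (MonoidAlgebra.of S Q) :=
    Submonoid.closure_le.2 h
  intro y
  induction y using MonoidAlgebra.induction_on with
  | of g =>
    refine hclosure ?_
    rw [← Subgroup.closure_toSubmonoid_of_finite, hs]
    exact Subgroup.mem_top g
  | add x y hx hy =>
    obtain ⟨a, rfl⟩ := hx
    obtain ⟨b, rfl⟩ := hy
    exact ⟨a + b, map_add _ _ _⟩
  | smul r x hx =>
    obtain ⟨a, rfl⟩ := hx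
    obtain ⟨r, rfl⟩ := hS r
    exact ⟨r • a, by rw [map_smul, algebraMap_smul]⟩

end Generation

section AdicTopology

variable {R : Type*} [CommRing R] {I : Ideal R}

theorem isTopologicalRing_of_isAdic [TopologicalSpace R] (hadic : IsAdic I) :
    IsTopologicalRing R :=
  hadic ▸ I.adic_basis.toRing_subgroups_basis.toRingFilterBasis.isTopologicalRing

theorem compactSpace_of_isAdic [UniformSpace R] [IsUniformAddGroup R] (hadic : IsAdic I)
    [IsPrecomplete I R] [∀ m, Finite (R ⧸ I ^ m)] : CompactSpace R := by
  have := hadic.isPrecomplete_iff.1 ‹_›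
  refine ⟨TotallyBounded.isCompact_of_isClosed ?_ isClosed_univ⟩
  refine hadic.hasBasis_nhds_zero.uniformity_of_nhds_zero.totallyBounded_iff.2 fun m _ => ?_
  refine ⟨Set.range (Quotient.out : R ⧸ I ^ m → R), Set.finite_range _, fun x _ => ?_⟩
  refine Set.mem_biUnion ⟨Ideal.Quotient.mk _ x, rfl⟩ ?_
  exact Ideal.Quotient.eq.1 (Ideal.Quotient.mk_out _)

end AdicTopology

section PowerSeries

variable {R : Type*} [CommRing R] (I : Ideal R)
variable {G : Type*} [CommGroup G] (N : ℕ →o (Subgroup G)ᵒᵈ)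

theorem algebraMap_level_eq_zero {m : ℕ} {r : R} (hr : r ∈ I ^ m) :
    algebraMap R (Level I N m) r = 0 := by
  rw [IsScalarTower.algebraMap_apply R (R ⧸ I ^ m) (Level I N m), Ideal.Quotient.algebraMap_eq,
    Ideal.Quotient.eq_zero_iff_mem.2 hr, map_zero]

theorem nat_card_level (m : ℕ) [Finite (G ⧸ sub N m)] :
    Nat.card (Level I N m) = Nat.card (R ⧸ I ^ m) ^ Nat.card (G ⧸ sub N m) := by
  rw [Nat.card_congr (MonoidAlgebra.coeffEquiv.trans Finsupp.equivFunOnFinite), Nat.card_fun]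

instance : UniformSpace (Alg I N) :=
  { IsTopologicalAddGroup.rightUniformSpace (Alg I N) with
    toTopologicalSpace := inferInstance }

instance : IsUniformAddGroup (Alg I N) := isUniformAddGroup_of_addCommGroup

instance : IsLinearTopology (Alg I N) (Alg I N) :=
  IsLinearTopology.mk_of_hasBasis _ (nhds_zero_hasBasis I N)

theorem continuousSMul_alg [TopologicalSpace R] (hadic : IsAdic I) :
    ContinuousSMul R (Alg I N) := by
  have := isTopologicalRing_of_isAdic hadic
  refine continuousSMul_of_algebraMap _ _ (continuous_of_preimage_ker_proj_mem_nhds _ fun m => ?_)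
  refine Filter.mem_of_superset (hadic.hasBasis_nhds_zero.mem_of_mem (i := m) trivial)
    fun r hr => ?_
  exact ((proj I N m).commutes r).trans (algebraMap_level_eq_zero I N hr)

variable {I N}

open MvPowerSeries.WithPiTopology

variable {σ : Type*} {a : σ → Alg I N}

theorem hasEval_of_pow_proj_eq_zero {d : ℕ → σ →₀ ℕ}
    (ha : ∀ m i, proj I N m (a i) ^ (d m i + 1) = 0) : MvPowerSeries.HasEval a where
  hpow i := (nhds_zero_hasBasis I N).tendsto_right_iff.2 fun m _ => by
    filter_upwards [Filter.eventually_ge_atTop (d m i + 1)] with n hn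
    rw [SetLike.mem_coe, RingHom.mem_ker, map_pow]
    exact pow_eq_zero_of_le hn (ha m i)
  tendsto_zero := (nhds_zero_hasBasis I N).tendsto_right_iff.2 fun m _ => by
    refine (d m).hasFiniteSupport.subset fun i hi => Function.mem_support.2 fun hd => hi ?_
    simpa [hd] using ha m i

variable [UniformSpace R] [IsUniformAddGroup R] [IsTopologicalRing R]
  [ContinuousSMul R (Alg I N)] [CompleteSpace (Alg I N)] (hEval : MvPowerSeries.HasEval a)

theorem proj_aeval_eq_zero {m : ℕ} {d : σ →₀ ℕ} (ha : ∀ i, proj I N m (a i) ^ (d i + 1) = 0)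
    {f : MvPowerSeries σ R} (hf : ∀ e ≤ d, MvPowerSeries.coeff e f ∈ I ^ m) :
    proj I N m (MvPowerSeries.aeval hEval f) = 0 := by
  have hterm (e : σ →₀ ℕ) : proj I N m
      (MvPowerSeries.coeff e f • e.prod fun i n => a i ^ n) = 0 := by
    rw [Algebra.smul_def, map_mul, AlgHom.commutes]
    by_cases he : e ≤ d
    · rw [algebraMap_level_eq_zero I N (hf e he), zero_mul]
    · obtain ⟨i, hi⟩ := not_forall.1 he
      rw [not_le] at hi
      have hmem : i ∈ e.support := Finsupp.mem_support_iff.2 (Nat.ne_zero_of_lt hi)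
      rw [Finsupp.prod, map_prod, Finset.prod_eq_zero hmem, mul_zero]
      rw [map_pow]
      exact pow_eq_zero_of_le hi (ha i)
  exact (isClosed_ker_proj I N m).mem_of_tendsto (MvPowerSeries.hasSum_aeval hEval f)
    (Filter.Eventually.of_forall fun s => sum_mem fun e _ => hterm e)

theorem proj_aeval_eq_zero_iff {m : ℕ} [Finite (R ⧸ I ^ m)] [Finite (G ⧸ sub N m)]
    {d : σ →₀ ℕ} (ha : ∀ i, proj I N m (a i) ^ (d i + 1) = 0)
    (hsurj : Function.Surjective fun f : MvPowerSeries σ R =>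
      proj I N m (MvPowerSeries.aeval hEval f))
    (hcard : Nat.card (Set.Iic d) ≤ Nat.card (G ⧸ sub N m)) {f : MvPowerSeries σ R} :
    proj I N m (MvPowerSeries.aeval hEval f) = 0 ↔
      ∀ e ≤ d, MvPowerSeries.coeff e f ∈ I ^ m := by
  classical
  refine ⟨fun hf e he => ?_, proj_aeval_eq_zero hEval ha⟩
  let φ (g : MvPowerSeries σ R) (e : Set.Iic d) : R ⧸ I ^ m :=
    Ideal.Quotient.mk _ (MvPowerSeries.coeff e.1 g)
  have hfactors : Function.FactorsThrough
      (fun g => proj I N m (MvPowerSeries.aeval hEval g)) φ := fun g h hgh => by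
    rw [← sub_eq_zero, ← map_sub, ← map_sub]
    refine proj_aeval_eq_zero hEval ha fun e he => ?_
    rw [map_sub]
    exact Ideal.Quotient.eq.1 (congrFun hgh ⟨e, he⟩)
  have : Finite (Set.Iic d) := Set.finite_Iic d
  have hcard' : Nat.card (Set.Iic d → R ⧸ I ^ m) ≤ Nat.card (Level I N m) := by
    rw [nat_card_level, Nat.card_fun]
    exact Nat.pow_le_pow_right Nat.card_pos hcard
  have hφ : φ f = φ 0 := factorsThrough_of_card_le hsurj hfactors hcard' (by simp [hf])
  simpa [φ, Ideal.Quotient.eq_zero_iff_mem] using congrFun hφ ⟨e, he⟩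

end PowerSeries

section PowerSeriesEquiv

variable {R : Type*} [CommRing R] {I : Ideal R}
variable {G : Type*} [CommGroup G] {N : ℕ →o (Subgroup G)ᵒᵈ}
variable {σ : Type*} {u : σ → G} {m : ℕ}

theorem proj_comp_surjective {B : Type*} [CommRing B] [Algebra R B] [Finite (G ⧸ sub N m)]
    (hgen : Subgroup.closure (Set.range u) ⊔ sub N m = ⊤) (ψ : B →ₐ[R] Alg I N)
    (hψ : ∀ i, of I N (u i) ∈ ψ.range) : Function.Surjective fun b => proj I N m (ψ b) := by
  have hquot : Subgroup.closure (QuotientGroup.mk' (sub N m) '' Set.range u) = ⊤ := by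
    rw [← MonoidHom.map_closure, ← Subgroup.map_top_of_surjective _
      (QuotientGroup.mk'_surjective _), Subgroup.map_eq_map_iff, QuotientGroup.ker_mk', hgen,
      top_sup_eq]
  refine surjective_monoidAlgebra_of_closure_eq_top Ideal.Quotient.mk_surjective
    ((proj I N m).comp ψ) hquot ?_
  rintro _ ⟨_, ⟨i, rfl⟩, rfl⟩
  obtain ⟨b, hb⟩ := hψ i
  exact ⟨b, (congrArg (proj I N m) hb).trans (proj_of I N m (u i))⟩

theorem proj_of_sub_one_pow_eq_zero {p : ℕ} [Fact p.Prime] [CharP R p] {g : G} {k : ℕ}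
    (hg : g ^ p ^ k ∈ sub N m) : proj I N m (of I N g - 1) ^ p ^ k = 0 := by
  rw [map_sub, map_one, sub_one_pow_char_pow R, proj_of, MonoidAlgebra.single_pow, one_pow,
    ← QuotientGroup.mk_pow, (QuotientGroup.eq_one_iff _).2 hg, ← MonoidAlgebra.one_def, sub_self]

theorem exists_le_of_cofinal {d : ℕ → σ →₀ ℕ} (hd : Monotone d) (hdtop : ∀ i c, ∃ m, c ≤ d m i)
    (e : σ →₀ ℕ) : ∃ m, e ≤ d m := by
  choose c hc using fun i => hdtop i (e i)
  refine ⟨e.support.sup c, fun i => ?_⟩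
  by_cases hi : i ∈ e.support
  · exact (hc i).trans (hd (Finset.le_sup hi) i)
  · rw [Finsupp.notMem_support_iff.1 hi]
    exact Nat.zero_le _

open MvPowerSeries.WithPiTopology in
/-- The isomorphism is evaluation at the `u i - 1`. The hypotheses say that `G / N m` looks like a
product of cyclic groups of orders `d m i + 1`, powers of `p`, with generators `u i`. -/
theorem exists_algEquiv_mvPowerSeries [TopologicalSpace R] (hadic : IsAdic I)
    [IsAdicComplete I R] [∀ m, Finite (R ⧸ I ^ m)] [∀ m, Finite (G ⧸ sub N m)]
    {p : ℕ} [Fact p.Prime] [CharP R p] {d : ℕ → σ →₀ ℕ} (hd : Monotone d)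
    (hdtop : ∀ i c, ∃ m, c ≤ d m i)
    (hpow : ∀ m i, ∃ k, d m i + 1 = p ^ k ∧ u i ^ p ^ k ∈ sub N m)
    (hgen : ∀ m, Subgroup.closure (Set.range u) ⊔ sub N m = ⊤)
    (hcard : ∀ m, Nat.card (Set.Iic (d m)) ≤ Nat.card (G ⧸ sub N m)) :
    ∃ f : Alg I N ≃ₐ[R] MvPowerSeries σ R, Continuous f ∧ Continuous f.symm := by
  have := isTopologicalRing_of_isAdic hadic
  let : UniformSpace R := IsTopologicalAddGroup.rightUniformSpace R
  have : IsUniformAddGroup R := isUniformAddGroup_of_addCommGroup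
  have := continuousSMul_alg I N hadic
  have : CompactSpace (Alg I N) := (alg_isProfiniteRing I N).compactSpace
  have : CompactSpace R := compactSpace_of_isAdic hadic
  have : CompactSpace (MvPowerSeries σ R) := Pi.compactSpace
  have ha (m : ℕ) (i : σ) : proj I N m (of I N (u i) - 1) ^ (d m i + 1) = 0 := by
    obtain ⟨k, hk, hu⟩ := hpow m i
    rw [hk, proj_of_sub_one_pow_eq_zero hu]
  have hEval := hasEval_of_pow_proj_eq_zero ha
  let ψ : MvPowerSeries σ R →ₐ[R] Alg I N := MvPowerSeries.aeval hEval
  have hcont : Continuous ψ := MvPowerSeries.continuous_aeval hEval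
  have hsurj (m : ℕ) : Function.Surjective fun f => proj I N m (ψ f) :=
    proj_comp_surjective (hgen m) ψ fun i => ⟨(MvPolynomial.X i + 1 : MvPolynomial σ R),
      (MvPowerSeries.aeval_coe hEval _).trans (by simp)⟩
  have hinj : Function.Injective ψ := by
    refine (injective_iff_map_eq_zero ψ).2 fun f hf => ?_
    ext e
    obtain ⟨m₀, hm₀⟩ := exists_le_of_cofinal hd hdtop e
    refine IsHausdorff.haus' (I := I) _ fun n => ?_
    rw [SModEq.zero, smul_eq_mul, Ideal.mul_top]
    have hlevel : proj I N (max n m₀) (ψ f) = 0 := by rw [hf, map_zero]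
    exact Ideal.pow_le_pow_right (le_max_left n m₀) <|
      (proj_aeval_eq_zero_iff hEval (ha _) (hsurj _) (hcard _)).1 hlevel e
        (hm₀.trans (hd (le_max_right _ _)))
  let ψe := AlgEquiv.ofBijective ψ ⟨hinj, surjective_of_surjective_proj hcont hsurj⟩
  exact ⟨ψe.symm, hcont.continuous_symm_of_equiv_compact_to_t2 (f := ψe.toEquiv), hcont⟩

end PowerSeriesEquiv

section OneUnits

variable {R : Type*} [CommRing R] {I : Ideal R}

theorem mem_oneAdd {m : ℕ} {u : Rˣ} : u ∈ oneAdd I m ↔ (u : R) - 1 ∈ I ^ m := by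
  rw [oneAdd, MonoidHom.mem_ker, Units.ext_iff, ← Ideal.Quotient.eq, map_one]
  rfl

theorem mem_sub_oneUnitFiltration {m : ℕ} {u : oneAdd I 1} :
    u ∈ sub (oneUnitFiltration I) m ↔ ((u : Rˣ) : R) - 1 ∈ I ^ m := mem_oneAdd

theorem inv_mul_mem_oneAdd {m : ℕ} {u v : Rˣ} :
    u⁻¹ * v ∈ oneAdd I m ↔ (v : R) - (u : R) ∈ I ^ m := by
  rw [mem_oneAdd, ← Ideal.unit_mul_mem_iff_mem _ u.isUnit, mul_sub, mul_one, Units.val_mul,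
    Units.mul_inv_cancel_left]

theorem exists_mem_oneAdd [IsAdicComplete I R] {m : ℕ} (hm : m ≠ 0) {x : R} (hx : x ∈ I ^ m) :
    ∃ u ∈ oneAdd I m, (u : R) = 1 + x := by
  have hjac : x ∈ Ideal.jacobson ⊥ :=
    IsAdicComplete.le_jacobson_bot I (Ideal.pow_le_self hm hx)
  obtain ⟨u, hu⟩ : IsUnit (1 + x) := by simpa [add_comm] using Ideal.mem_jacobson_bot.1 hjac 1
  exact ⟨u, by rwa [mem_oneAdd, hu, add_sub_cancel_left], hu⟩

instance finite_quot_unitFiltration [∀ m, Finite (R ⧸ I ^ m)] (m : ℕ) :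
    Finite (Rˣ ⧸ sub (unitFiltration I) m) :=
  Finite.of_injective _ (QuotientGroup.kerLift_injective
    (Units.map (Ideal.Quotient.mk (I ^ m) : R →* R ⧸ I ^ m)))

instance finite_quot_oneUnitFiltration [∀ m, Finite (R ⧸ I ^ m)] (m : ℕ) :
    Finite (oneAdd I 1 ⧸ sub (oneUnitFiltration I) m) :=
  have : Finite (Rˣ ⧸ oneAdd I m) := finite_quot_unitFiltration m
  have : (oneAdd I m).FiniteIndex := Subgroup.finiteIndex_of_finite_quotient
  Subgroup.finite_quotient_of_finiteIndex (H := (oneAdd I m).subgroupOf (oneAdd I 1))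

section LeadingCoeffs

variable {t : R} (H : Subgroup (oneAdd I 1)) (ht : t ∈ I) {n : ℕ} (hn : n ≠ 0)

/-- The leading coefficients of the elements of `H` at `t ^ n`: those `b` for which `H` contains
an element congruent to `1 + b * t ^ n` modulo `I ^ (n + 1)`. -/
def leadingCoeffs : AddSubmonoid R where
  carrier := {b | ∃ h ∈ H, ((h : Rˣ) : R) - (1 + b * t ^ n) ∈ I ^ (n + 1)}
  zero_mem' := ⟨1, one_mem _, by simp⟩
  add_mem' := by
    rintro b c ⟨h, hh, hb⟩ ⟨k, hk, hc⟩
    refine ⟨h * k, mul_mem hh hk, ?_⟩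
    have hcross : b * c * t ^ (n + n) ∈ I ^ (n + 1) :=
      Ideal.mul_mem_left _ _ (Ideal.pow_le_pow_right (by omega) (Ideal.pow_mem_pow ht _))
    convert add_mem (add_mem (Ideal.mul_mem_right ((k : Rˣ) : R) _ hb)
      (Ideal.mul_mem_left _ (1 + b * t ^ n) hc)) hcross using 1
    simp only [Subgroup.coe_mul, Units.val_mul]
    ring

variable {H}

theorem mem_leadingCoeffs {b : R} : b ∈ leadingCoeffs H ht hn ↔
    ∃ h ∈ H, ((h : Rˣ) : R) - (1 + b * t ^ n) ∈ I ^ (n + 1) := Iff.rfl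

theorem mem_leadingCoeffs_of_mem {c : R} (hc : c ∈ I) : c ∈ leadingCoeffs H ht hn := by
  refine ⟨1, one_mem _, ?_⟩
  simpa [pow_succ'] using Ideal.mul_mem_mul hc (Ideal.pow_mem_pow ht n)

theorem leadingCoeffs_eq_top_of_map_eq_top
    (h : (leadingCoeffs H ht hn).map (Ideal.Quotient.mk I) = ⊤) : leadingCoeffs H ht hn = ⊤ := by
  refine (AddSubmonoid.eq_top_iff' _).2 fun b => ?_
  obtain ⟨c, hc, hcb⟩ := AddSubmonoid.mem_map.1 (h ▸ AddSubmonoid.mem_top (Ideal.Quotient.mk I b))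
  rw [← add_sub_cancel c b]
  exact add_mem hc (mem_leadingCoeffs_of_mem ht hn (Ideal.Quotient.eq.1 hcb.symm))

theorem leadingCoeffs_eq_top_of_closure {ι : Type*} {a : ι → R}
    (ha : AddSubmonoid.closure (Set.range fun i => Ideal.Quotient.mk I (a i)) = ⊤)
    (hH : ∀ i, ∃ h ∈ H, ((h : Rˣ) : R) = 1 + a i * t ^ n) : leadingCoeffs H ht hn = ⊤ := by
  refine leadingCoeffs_eq_top_of_map_eq_top ht hn (top_le_iff.1 (ha.ge.trans ?_))
  rw [AddSubmonoid.closure_le, Set.range_subset_iff]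
  refine fun i => AddSubmonoid.mem_map_of_mem _ ?_
  obtain ⟨h, hh, he⟩ := hH i
  exact ⟨h, hh, by rw [he, sub_self]; exact zero_mem _⟩

variable {p : ℕ} [Fact p.Prime] [CharP R p]

theorem pow_char_pow_mem_leadingCoeffs {b : R} (hb : b ∈ leadingCoeffs H ht hn) (j : ℕ)
    (hjn : p ^ j * n ≠ 0) : b ^ p ^ j ∈ leadingCoeffs H ht hjn := by
  obtain ⟨h, hh, hhb⟩ := hb
  refine ⟨h ^ p ^ j, pow_mem hh _, ?_⟩
  have hle : p ^ j * n + 1 ≤ (n + 1) * p ^ j := by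
    have : p ^ j ≠ 0 := left_ne_zero_of_mul hjn
    lia
  convert Ideal.pow_le_pow_right hle (pow_mul I _ _ ▸ Ideal.pow_mem_pow hhb (p ^ j)) using 1
  rw [sub_pow_char_pow, add_pow_char_pow, one_pow, mul_pow, ← pow_mul, mul_comm n,
    Subgroup.coe_pow, Units.val_pow_eq_pow_val]

theorem leadingCoeffs_pow_mul_eq_top [I.IsMaximal] [Finite (R ⧸ I)]
    (h : leadingCoeffs H ht hn = ⊤) (j : ℕ) (hjn : p ^ j * n ≠ 0) :
    leadingCoeffs H ht hjn = ⊤ := by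
  let _ : Field (R ⧸ I) := Ideal.Quotient.field I
  have := charP_quotient I p
  have hFrobenius : Function.Surjective (iterateFrobenius (R ⧸ I) p j) :=
    Finite.surjective_of_injective (iterateFrobenius_inj (R ⧸ I) p j)
  refine leadingCoeffs_eq_top_of_map_eq_top ht hjn ((AddSubmonoid.eq_top_iff' _).2 fun c => ?_)
  obtain ⟨b, rfl⟩ := (hFrobenius.comp Ideal.Quotient.mk_surjective) c
  refine ⟨b ^ p ^ j, pow_char_pow_mem_leadingCoeffs ht hn (h ▸ AddSubmonoid.mem_top b) j hjn, ?_⟩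
  rw [map_pow]
  rfl

theorem leadingCoeffs_eq_top_of_not_dvd [I.IsMaximal] [Finite (R ⧸ I)]
    (h : ∀ m (hm : m ≠ 0), ¬ p ∣ m → leadingCoeffs H ht hm = ⊤) : leadingCoeffs H ht hn = ⊤ := by
  obtain ⟨j, m, hm, rfl⟩ :=
    Nat.exists_eq_pow_mul_and_not_dvd hn p (Fact.out : p.Prime).ne_one
  exact leadingCoeffs_pow_mul_eq_top ht _ (h m (right_ne_zero_of_mul hn) hm) j hn

end LeadingCoeffs

theorem sub_oneUnitFiltration_eq_top {m : ℕ} (hm : m ≤ 1) : sub (oneUnitFiltration I) m = ⊤ :=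
  eq_top_iff.2 fun u _ => oneAdd_anti I hm u.2

theorem sup_sub_oneUnitFiltration_eq_top {t : R} (hI : I = Ideal.span {t}) (ht : t ∈ I)
    {H : Subgroup (oneAdd I 1)} (hH : ∀ n (hn : n ≠ 0), leadingCoeffs H ht hn = ⊤) (m : ℕ) :
    H ⊔ sub (oneUnitFiltration I) m = ⊤ := by
  induction m with
  | zero => rw [sub_oneUnitFiltration_eq_top zero_le_one, sup_top_eq]
  | succ m ih =>
    rcases eq_or_ne m 0 with rfl | hm
    · rw [sub_oneUnitFiltration_eq_top le_rfl, sup_top_eq]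
    rw [eq_top_iff, ← ih, sup_le_iff]
    refine ⟨le_sup_left, fun u hu => ?_⟩
    obtain ⟨b, hb⟩ : ∃ b, b * t ^ m = ((u : Rˣ) : R) - 1 := by
      rw [← Ideal.mem_span_singleton', ← Ideal.span_singleton_pow, ← hI]
      exact mem_sub_oneUnitFiltration.1 hu
    obtain ⟨h, hh, hhb⟩ := (mem_leadingCoeffs ht hm).1 (hH m hm ▸ AddSubmonoid.mem_top b)
    rw [hb, add_sub_cancel] at hhb
    have hhu : h⁻¹ * u ∈ sub (oneUnitFiltration I) (m + 1) :=
      inv_mul_mem_oneAdd.2 (by rw [← neg_sub]; exact neg_mem hhb)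
    rw [← mul_inv_cancel_left h u]
    exact mul_mem (Subgroup.mem_sup_left hh) (Subgroup.mem_sup_right hhu)

section Card

variable [IsAdicComplete I R] [hmax : I.IsMaximal] {t : R}

theorem mem_of_mul_pow_mem (hI : I = Ideal.span {t}) (ht : ¬ IsNilpotent t) {a : R} {m : ℕ}
    (ha : a * t ^ m ∈ I ^ (m + 1)) : a ∈ I := by
  by_contra haI
  obtain ⟨b, i, hi, hbi⟩ := hmax.exists_inv haI
  have htI : t ∈ I := hI ▸ Ideal.mem_span_singleton_self t
  have hpow : t ^ m ∈ I ^ (m + 1) := by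
    rw [← one_mul (t ^ m), ← hbi, add_mul, mul_assoc]
    exact add_mem (Ideal.mul_mem_left _ b ha)
      (pow_succ' I m ▸ Ideal.mul_mem_mul hi (Ideal.pow_mem_pow htI m))
  rw [hI, Ideal.span_singleton_pow, Ideal.mem_span_singleton'] at hpow
  obtain ⟨c, hc⟩ := hpow
  have hunit : IsUnit (t * -c + 1) :=
    Ideal.mem_jacobson_bot.1 (IsAdicComplete.le_jacobson_bot I htI) (-c)
  exact ht ⟨m, (hunit.mul_left_eq_zero).1 (by linear_combination -hc)⟩

variable [∀ m, Finite (R ⧸ I ^ m)]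

theorem card_le_relIndex_oneAdd (hI : I = Ideal.span {t}) (ht : ¬ IsNilpotent t) {m : ℕ}
    (hm : m ≠ 0) : Nat.card (R ⧸ I) ≤ (oneAdd I (m + 1)).relIndex (oneAdd I m) := by
  have htI : t ∈ I := hI ▸ Ideal.mem_span_singleton_self t
  choose u hu hut using fun a : R ⧸ I =>
    exists_mem_oneAdd hm (Ideal.mul_mem_left _ a.out (Ideal.pow_mem_pow htI m))
  have : Finite (Rˣ ⧸ oneAdd I (m + 1)) := finite_quot_unitFiltration (m + 1)
  have : (oneAdd I (m + 1)).FiniteIndex := Subgroup.finiteIndex_of_finite_quotient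
  refine Nat.card_le_card_of_injective
    (fun a => (QuotientGroup.mk ⟨u a, hu a⟩ :
      oneAdd I m ⧸ (oneAdd I (m + 1)).subgroupOf (oneAdd I m))) fun a b hab => ?_
  have hinv := QuotientGroup.eq.1 hab
  have hmem : (u b : R) - u a ∈ I ^ (m + 1) := inv_mul_mem_oneAdd.1 hinv
  rw [hut, hut, add_sub_add_left_eq_sub, ← sub_mul] at hmem
  have hout (a : R ⧸ I) : Ideal.Quotient.mk I a.out = a := Quotient.out_eq a
  rw [← hout a, ← hout b]
  exact (Ideal.Quotient.eq.2 (mem_of_mul_pow_mem hI ht hmem)).symm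

theorem card_pow_le_card_quot_oneUnits (hI : I = Ideal.span {t}) (ht : ¬ IsNilpotent t) (m : ℕ) :
    Nat.card (R ⧸ I) ^ (m - 1) ≤ Nat.card (oneAdd I 1 ⧸ sub (oneUnitFiltration I) m) := by
  rcases m with - | m
  · exact Nat.card_pos
  change _ ≤ (oneAdd I (m + 1)).relIndex (oneAdd I 1)
  induction m with
  | zero => simp
  | succ m ih =>
    rw [← Subgroup.relIndex_mul_relIndex _ (oneAdd I (m + 1)) _ (oneAdd_anti I (Nat.le_succ _))
      (oneAdd_anti I (Nat.le_add_left 1 m)), Nat.add_sub_cancel, pow_succ']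
    exact Nat.mul_le_mul (card_le_relIndex_oneAdd hI ht m.succ_ne_zero) ih

end Card

end OneUnits

section Exponent

variable {p n m : ℕ}

/-- The least `k` with `m ≤ n * p ^ k`, for `1 < p` and `0 < n`: then `1 + t ^ n` has order `p ^ k`
modulo `t ^ m` over a ring of characteristic `p` in which `t` is not nilpotent. -/
def exponent (p n m : ℕ) : ℕ := Nat.clog p (m ⌈/⌉ n)

theorem exponent_le_iff (hp : 1 < p) (hn : 0 < n) {k : ℕ} : exponent p n m ≤ k ↔ m ≤ n * p ^ k := by
  rw [exponent, Nat.clog_le_iff_le_pow hp, ceilDiv_le_iff_le_mul hn]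

theorem le_mul_pow_exponent (hp : 1 < p) (hn : 0 < n) (m : ℕ) : m ≤ n * p ^ exponent p n m :=
  (exponent_le_iff hp hn).1 le_rfl

theorem exponent_eq_zero (hp : 1 < p) (hn : 0 < n) (h : m ≤ n) : exponent p n m = 0 :=
  Nat.le_zero.1 ((exponent_le_iff hp hn).2 (by simpa using h))

theorem exponent_mono (hp : 1 < p) (hn : 0 < n) : Monotone (exponent p n) := fun _ b hab =>
  (exponent_le_iff hp hn).2 (hab.trans (le_mul_pow_exponent hp hn b))

theorem le_exponent (hp : 1 < p) (hn : 0 < n) (c : ℕ) : c ≤ exponent p n (n * p ^ c) := by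
  have h := le_mul_pow_exponent hp hn (n * p ^ c)
  exact (Nat.pow_le_pow_iff_right hp).1 (Nat.le_of_mul_le_mul_left h hn)

theorem pos_of_not_dvd (n : {n : ℕ // ¬ p ∣ n}) : 0 < (n : ℕ) :=
  Nat.pos_of_ne_zero fun h => n.2 (h ▸ dvd_zero p)

theorem injective_mul_pow (hp : p.Prime) :
    Function.Injective fun x : (_ : {n : ℕ // ¬ p ∣ n}) × ℕ => (x.1 : ℕ) * p ^ x.2 := by
  rintro ⟨n, j⟩ ⟨n', j'⟩ (h : (n : ℕ) * p ^ j = n' * p ^ j')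
  have hfactorization (n : {n : ℕ // ¬ p ∣ n}) (j : ℕ) :
      ((n : ℕ) * p ^ j).factorization p = j := by
    rw [Nat.factorization_mul (pos_of_not_dvd n).ne' (pow_ne_zero _ hp.ne_zero), Finsupp.add_apply,
      Nat.factorization_eq_zero_of_not_dvd n.2, hp.factorization_pow, Finsupp.single_eq_same,
      zero_add]
  obtain rfl : j = j' := by rw [← hfactorization n j, h, hfactorization]
  obtain rfl : n = n' := Subtype.ext (Nat.eq_of_mul_eq_mul_right (Nat.pow_pos hp.pos) h)
  rfl

theorem sum_exponent_le (hp : p.Prime) (m : ℕ) (S : Finset {n : ℕ // ¬ p ∣ n}) :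
    ∑ n ∈ S, exponent p n m ≤ m - 1 := by
  have hmaps : Set.MapsTo (fun x : (_ : {n : ℕ // ¬ p ∣ n}) × ℕ => (x.1 : ℕ) * p ^ x.2)
      (S.sigma fun n => Finset.range (exponent p n m)) (Finset.Ioo 0 m) := by
    rintro ⟨n, j⟩ hx
    have hj : ¬ exponent p n m ≤ j := not_le.2 (Finset.mem_range.1 (Finset.mem_sigma.1 hx).2)
    rw [exponent_le_iff hp.one_lt (pos_of_not_dvd n), not_le] at hj
    exact Finset.mem_Ioo.2 ⟨Nat.mul_pos (pos_of_not_dvd n) (Nat.pow_pos hp.pos), hj⟩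
  simpa only [Finset.card_sigma, Finset.card_range, Nat.card_Ioo, Nat.sub_zero] using
    Finset.card_le_card_of_injOn _ hmaps (injective_mul_pow hp).injOn

variable (p) in
/-- The exponents `p ^ exponent p n m - 1`, indexed by the pairs `(n, i)` with `n` prime to `p`. -/
def degreeBound {ι : Type*} [Fintype ι] (hp : 1 < p) (m : ℕ) : {n : ℕ // ¬ p ∣ n} × ι →₀ ℕ :=
  Finsupp.onFinset ((Finset.range m).subtype (¬ p ∣ ·) ×ˢ Finset.univ)
    (fun i => p ^ exponent p i.1 m - 1) fun i hi => by
      simp only [Finset.mem_product, Finset.mem_subtype, Finset.mem_range, Finset.mem_univ,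
        and_true]
      by_contra! h
      exact hi (by rw [exponent_eq_zero hp (pos_of_not_dvd i.1) h, pow_zero, Nat.sub_self])

variable {ι : Type*} [Fintype ι]

theorem degreeBound_add_one (hp : 1 < p) (m : ℕ) (i : {n : ℕ // ¬ p ∣ n} × ι) :
    degreeBound p hp m i + 1 = p ^ exponent p i.1 m :=
  Nat.sub_add_cancel (Nat.pow_pos (zero_lt_one.trans hp))

theorem degreeBound_mono (hp : 1 < p) : Monotone (degreeBound p (ι := ι) hp) := fun a b hab i => by
  rw [← Nat.add_le_add_iff_right (n := 1), degreeBound_add_one, degreeBound_add_one]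
  exact Nat.pow_le_pow_right (zero_lt_one.trans hp)
    (exponent_mono hp (pos_of_not_dvd i.1) hab)

theorem exists_le_degreeBound (hp : 1 < p) (i : {n : ℕ // ¬ p ∣ n} × ι) (c : ℕ) :
    ∃ m, c ≤ degreeBound p hp m i := by
  refine ⟨i.1 * p ^ c, Nat.le_of_lt_succ ?_⟩
  rw [Nat.succ_eq_add_one, degreeBound_add_one]
  exact (Nat.lt_pow_self hp).trans_le
    (Nat.pow_le_pow_right (zero_lt_one.trans hp) (le_exponent hp (pos_of_not_dvd i.1) c))

theorem card_Iic_degreeBound_le (hp : p.Prime) (m : ℕ) :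
    Nat.card (Set.Iic (degreeBound p (ι := ι) hp.one_lt m)) ≤ (p ^ Fintype.card ι) ^ (m - 1) := by
  classical
  have hsupport : (degreeBound p (ι := ι) hp.one_lt m).support ⊆
      (Finset.range m).subtype (¬ p ∣ ·) ×ˢ Finset.univ := Finsupp.support_onFinset_subset
  calc Nat.card (Set.Iic (degreeBound p (ι := ι) hp.one_lt m))
      = (Finset.Iic (degreeBound p (ι := ι) hp.one_lt m)).card := by
        rw [← Finset.coe_Iic, Nat.card_coe_set_eq, Set.ncard_coe_finset]
    _ = ∏ i ∈ (Finset.range m).subtype (¬ p ∣ ·) ×ˢ Finset.univ,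
          (degreeBound p (ι := ι) hp.one_lt m i + 1) := by
        simp only [Finsupp.card_Iic, Nat.card_Iic]
        exact Finset.prod_subset hsupport fun i _ hi => by
          rw [Finsupp.notMem_support_iff.1 hi, zero_add]
    _ = (p ^ Fintype.card ι) ^ ∑ n ∈ (Finset.range m).subtype (¬ p ∣ ·), exponent p n m := by
        simp only [degreeBound_add_one, Finset.prod_product, Finset.prod_const, Finset.card_univ]
        rw [Finset.prod_pow, Finset.prod_pow_eq_pow_sum, pow_right_comm]
    _ ≤ (p ^ Fintype.card ι) ^ (m - 1) :=
        Nat.pow_le_pow_right (Nat.pow_pos hp.pos) (sum_exponent_le hp m _)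

end Exponent

section OneUnitsPowerSeries

theorem exists_closure_range_eq_top_and_card_eq (V : Type*) [AddCommGroup V] [Finite V] (p : ℕ)
    [Fact p.Prime] [Module (ZMod p) V] :
    ∃ (f : ℕ) (b : Fin f → V), AddSubmonoid.closure (Set.range b) = ⊤ ∧ Nat.card V = p ^ f := by
  let b := Module.finBasis (ZMod p) V
  refine ⟨_, b, (AddSubmonoid.eq_top_iff' _).2 fun x => ?_, ?_⟩
  · rw [← b.sum_repr x]
    refine sum_mem fun i _ => ?_
    rw [← ZMod.natCast_zmod_val (b.repr x i), Nat.cast_smul_eq_nsmul]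
    exact nsmul_mem (AddSubmonoid.subset_closure (Set.mem_range_self i)) _
  · rw [Module.natCard_eq_pow_finrank (K := ZMod p), Nat.card_zmod]

theorem infinite_not_dvd {p : ℕ} (hp : 1 < p) : Infinite {n : ℕ // ¬ p ∣ n} :=
  Infinite.of_injective (fun n : ℕ => ⟨p * n + 1, fun h => hp.ne'
    (Nat.dvd_one.1 ((Nat.dvd_add_right (dvd_mul_right p n)).1 h))⟩) fun _ _ hxy =>
      Nat.eq_of_mul_eq_mul_left (zero_lt_one.trans hp) (Nat.succ_injective (Subtype.ext_iff.1 hxy))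

open MvPowerSeries.WithPiTopology in
theorem continuous_rename {R σ τ : Type*} [CommSemiring R] [TopologicalSpace R]
    [IsTopologicalSemiring R] (f : σ → τ) [Filter.TendstoCofinite f] :
    Continuous (MvPowerSeries.rename (R := R) f) :=
  continuous_pi fun _ => continuous_finsetSum _ fun d _ =>
    MvPowerSeries.WithPiTopology.continuous_coeff R d

variable {R : Type*} [CommRing R] [TopologicalSpace R] {I : Ideal R} [IsAdicComplete I R]
variable [I.IsMaximal] [Finite (R ⧸ I)] {t : R}

open MvPowerSeries.WithPiTopology in
theorem exists_oneUnit_algEquiv_mvPowerSeries_of_closure {p : ℕ} [Fact p.Prime]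
    [CharP R p] (hadic : IsAdic I)
    (hI : I = Ideal.span {t}) (ht : ¬ IsNilpotent t) {ι : Type*} [Fintype ι] {a : ι → R}
    (ha : AddSubmonoid.closure (Set.range fun i => Ideal.Quotient.mk I (a i)) = ⊤)
    (hcard : Nat.card (R ⧸ I) = p ^ Fintype.card ι) :
    ∃ f : Alg I (oneUnitFiltration I) ≃ₐ[R] MvPowerSeries ({n : ℕ // ¬ p ∣ n} × ι) R,
      Continuous f ∧ Continuous f.symm := by
  have (m : ℕ) : Finite (R ⧸ I ^ m) := Ideal.finite_quotient_pow (hI ▸ ⟨{t}, by simp⟩) m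
  have hp : p.Prime := Fact.out
  have htI : t ∈ I := hI ▸ Ideal.mem_span_singleton_self t
  have hmem (i : {n : ℕ // ¬ p ∣ n} × ι) : a i.2 * t ^ (i.1 : ℕ) ∈ I ^ 1 :=
    Ideal.mul_mem_left _ _ (Ideal.pow_le_pow_right (pos_of_not_dvd i.1) (Ideal.pow_mem_pow htI _))
  choose u hu hut using fun i => exists_mem_oneAdd one_ne_zero (hmem i)
  refine exists_algEquiv_mvPowerSeries (u := fun i => (⟨u i, hu i⟩ : oneAdd I 1)) hadic
    (degreeBound_mono hp.one_lt) (exists_le_degreeBound hp.one_lt) (fun m i => ?_)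
    (sup_sub_oneUnitFiltration_eq_top hI htI fun n hn =>
      leadingCoeffs_eq_top_of_not_dvd htI hn fun k hk hpk =>
        leadingCoeffs_eq_top_of_closure htI hk ha fun i =>
          ⟨_, Subgroup.subset_closure ⟨(⟨k, hpk⟩, i), rfl⟩, hut _⟩)
    fun m => (card_Iic_degreeBound_le hp m).trans
      (hcard ▸ card_pow_le_card_quot_oneUnits hI ht m)
  refine ⟨_, degreeBound_add_one hp.one_lt m i, ?_⟩
  rw [mem_sub_oneUnitFiltration, Subgroup.coe_pow, Units.val_pow_eq_pow_val, hut,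
    add_pow_char_pow, one_pow, add_sub_cancel_left, mul_pow, ← pow_mul]
  exact Ideal.mul_mem_left _ _ (Ideal.pow_le_pow_right
    (le_mul_pow_exponent hp.one_lt (pos_of_not_dvd i.1) m) (Ideal.pow_mem_pow htI _))

open MvPowerSeries.WithPiTopology in
theorem exists_oneUnit_algEquiv_mvPowerSeries (hadic : IsAdic I)
    (hI : I = Ideal.span {t}) (ht : ¬ IsNilpotent t) (p : ℕ) [Fact p.Prime] [CharP R p] :
    ∃ f : Alg I (oneUnitFiltration I) ≃ₐ[R] MvPowerSeries ℕ R,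
      Continuous f ∧ Continuous f.symm := by
  have := isTopologicalRing_of_isAdic hadic
  have : Nontrivial (R ⧸ I) := Ideal.Quotient.nontrivial_iff.2 (Ideal.IsMaximal.ne_top ‹_›)
  have := charP_quotient I p
  let _ : Algebra (ZMod p) (R ⧸ I) := ZMod.algebra _ p
  obtain ⟨f, b, hb, hcard⟩ := exists_closure_range_eq_top_and_card_eq (R ⧸ I) p
  choose a ha using fun i => Ideal.Quotient.mk_surjective (b i)
  have : Nonempty (Fin f) := Fin.pos_iff_nonempty.1 <| Nat.pos_of_ne_zero fun hf =>
    Finite.one_lt_card.ne' (hcard.trans (by rw [hf, pow_zero]))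
  have := infinite_not_dvd (Fact.out : p.Prime).one_lt
  obtain ⟨e⟩ : Nonempty ({n : ℕ // ¬ p ∣ n} × Fin f ≃ ℕ) := nonempty_equiv_of_countable
  obtain ⟨g, hg, hgsymm⟩ := exists_oneUnit_algEquiv_mvPowerSeries_of_closure (p := p) hadic hI ht
    (a := a) (by simpa only [ha] using hb) (by rw [hcard, Fintype.card_fin])
  exact ⟨g.trans (MvPowerSeries.renameEquiv R e), (continuous_rename e).comp hg,
    hgsymm.comp (continuous_rename e.symm)⟩

end OneUnitsPowerSeries

section Teichmuller

variable {R : Type*} [CommRing R] (I : Ideal R)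

/-- Reduction of units `Rˣ → (R/I)ˣ`. -/
abbrev red : Rˣ →* (R ⧸ I)ˣ := Units.map (Ideal.Quotient.mk I : R →* R ⧸ I)

variable {I}

theorem red_eq_one_iff {u : Rˣ} : red I u = 1 ↔ u ∈ oneAdd I 1 := by
  rw [mem_oneAdd, pow_one, ← Ideal.Quotient.eq, map_one, Units.ext_iff]
  rfl

variable [I.IsMaximal]

variable (I) in
theorem natCast_card_residue_units_notMem [Finite (R ⧸ I)] : (Nat.card (R ⧸ I)ˣ : R) ∉ I := by
  let _ := Ideal.Quotient.field I
  intro h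
  have hcard : Nat.card (R ⧸ I)ˣ + 1 = Nat.card (R ⧸ I) := by
    rw [Nat.card_units, Nat.sub_add_cancel Nat.card_pos]
  have hzero : ((Nat.card (R ⧸ I)ˣ + 1 : ℕ) : R ⧸ I) = 0 := by
    rw [hcard, ← nsmul_one, card_nsmul_eq_zero']
  rw [← Ideal.Quotient.eq_zero_iff_mem, map_natCast] at h
  rw [Nat.cast_succ, h, zero_add] at hzero
  exact one_ne_zero hzero

variable [IsAdicComplete I R]

theorem isUnit_of_notMem {x : R} (hx : x ∉ I) : IsUnit x := by
  let _ := Ideal.Quotient.field I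
  have := isLocalHom_of_le_jacobson_bot I (IsAdicComplete.le_jacobson_bot I)
  refine isUnit_of_map_unit (Ideal.Quotient.mk I) x (isUnit_iff_ne_zero.2 ?_)
  rwa [Ne, Ideal.Quotient.eq_zero_iff_mem]

theorem eq_one_of_red_eq_one_of_pow_eq_one {n : ℕ} (hn : (n : R) ∉ I) {ζ : Rˣ}
    (hred : red I ζ = 1) (hζ : ζ ^ n = 1) : ζ = 1 := by
  have hsum : IsUnit (∑ i ∈ Finset.range n, (ζ : R) ^ i) := by
    refine isUnit_of_notMem (I := I) fun hmem => hn ?_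
    have hone : Ideal.Quotient.mk I ζ = 1 := congrArg Units.val hred
    rw [← Ideal.Quotient.eq_zero_iff_mem] at hmem ⊢
    simpa [hone] using hmem
  have hgeom : (∑ i ∈ Finset.range n, (ζ : R) ^ i) * ((ζ : R) - 1) = 0 := by
    rw [geom_sum_mul, ← Units.val_pow_eq_pow_val, hζ, Units.val_one, sub_self]
  exact Units.ext (sub_eq_zero.1 (hsum.mul_right_eq_zero.1 hgeom))

theorem eq_of_red_eq_of_pow_eq_one {n : ℕ} (hn : (n : R) ∉ I) {ζ ζ' : Rˣ}
    (hred : red I ζ = red I ζ') (hζ : ζ ^ n = 1) (hζ' : ζ' ^ n = 1) : ζ = ζ' :=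
  div_eq_one.1 <| eq_one_of_red_eq_one_of_pow_eq_one hn
    (by rw [_root_.map_div, hred, div_self']) (by rw [div_pow, hζ, hζ', div_one])

open Polynomial in
theorem exists_pow_eq_one_red_eq {n : ℕ} (hn : (n : R) ∉ I) {c : (R ⧸ I)ˣ} (hc : c ^ n = 1) :
    ∃ ζ : Rˣ, ζ ^ n = 1 ∧ red I ζ = c := by
  have hn0 : n ≠ 0 := by
    rintro rfl
    exact hn (by rw [Nat.cast_zero]; exact zero_mem I)
  obtain ⟨a₀, ha₀⟩ := Ideal.Quotient.mk_surjective (c : R ⧸ I)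
  have hroot : (X ^ n - 1 : R[X]).eval a₀ ∈ I := by
    rw [← Ideal.Quotient.eq_zero_iff_mem, eval_sub, eval_pow, eval_X, eval_one, map_sub, map_pow,
      ha₀, ← Units.val_pow_eq_pow_val, hc, Units.val_one, map_one, sub_self]
  have hderiv : IsUnit (Ideal.Quotient.mk I ((X ^ n - 1 : R[X]).derivative.eval a₀)) := by
    have hunit : IsUnit (Ideal.Quotient.mk I a₀) := ha₀ ▸ c.isUnit
    rw [derivative_sub, derivative_one, sub_zero, derivative_X_pow, eval_mul, eval_C, eval_pow,
      eval_X, map_mul, map_pow]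
    exact ((isUnit_of_notMem hn).map _).mul (hunit.pow _)
  obtain ⟨a, ha, haa₀⟩ := HenselianRing.is_henselian (I := I) (X ^ n - 1 : R[X])
    (monic_X_pow_sub_C 1 hn0) a₀ hroot hderiv
  have hpow : a ^ n = 1 := by
    simpa [IsRoot.def, sub_eq_zero] using ha
  refine ⟨Units.ofPowEqOne a n hpow hn0, Units.pow_ofPowEqOne _ hn0, Units.ext ?_⟩
  exact (Ideal.Quotient.eq.2 haa₀).trans ha₀

variable [Finite (R ⧸ I)]

theorem existsUnique_pow_card_eq_one_red_eq (c : (R ⧸ I)ˣ) :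
    ∃! ζ : Rˣ, ζ ^ Nat.card (R ⧸ I)ˣ = 1 ∧ red I ζ = c := by
  obtain ⟨ζ, hζ, hred⟩ :=
    exists_pow_eq_one_red_eq (natCast_card_residue_units_notMem I) (pow_card_eq_one' (x := c))
  refine ⟨ζ, ⟨hζ, hred⟩, fun ζ' hζ' => ?_⟩
  exact eq_of_red_eq_of_pow_eq_one (natCast_card_residue_units_notMem I)
    (hζ'.2.trans hred.symm) hζ'.1 hζ

variable (I) in
/-- The Teichmüller character: the section of `red I` whose values are roots of unity of order
dividing `#(R/I)ˣ`. -/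
def teichmuller : (R ⧸ I)ˣ →* Rˣ :=
  have h c := (existsUnique_pow_card_eq_one_red_eq (I := I) c).choose_spec.1
  MonoidHom.mk' (fun c => (existsUnique_pow_card_eq_one_red_eq c).choose) fun a b =>
    eq_of_red_eq_of_pow_eq_one (natCast_card_residue_units_notMem I)
      (by rw [map_mul, (h _).2, (h _).2, (h _).2]) (h _).1
      (by rw [mul_pow, (h _).1, (h _).1, one_mul])

theorem red_teichmuller (c : (R ⧸ I)ˣ) : red I (teichmuller I c) = c :=
  (existsUnique_pow_card_eq_one_red_eq c).choose_spec.1.2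

theorem teichmuller_red {ζ : Rˣ} (hζ : ζ ^ Nat.card (R ⧸ I)ˣ = 1) :
    teichmuller I (red I ζ) = ζ :=
  ((existsUnique_pow_card_eq_one_red_eq (red I ζ)).choose_spec.2 ζ ⟨hζ, rfl⟩).symm

end Teichmuller

section Characters

theorem hom_pow_card {G M : Type*} [Group G] [Monoid M] (χ : G →* M) (c : G) :
    χ c ^ Nat.card G = 1 := by
  rw [← map_pow, pow_card_eq_one', map_one]

variable {R : Type*} [CommRing R] {I : Ideal R} [I.IsMaximal] [IsAdicComplete I R]
  [Finite (R ⧸ I)]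

instance finite_chars : Finite ((R ⧸ I)ˣ →* Rˣ) := by
  refine Finite.of_injective (fun χ => (red I).comp χ) fun χ χ' h => MonoidHom.ext fun c => ?_
  exact eq_of_red_eq_of_pow_eq_one (natCast_card_residue_units_notMem I) (DFunLike.congr_fun h c)
    (hom_pow_card χ c) (hom_pow_card χ' c)

theorem sum_char_eq_zero [Fintype (R ⧸ I)ˣ] {χ : (R ⧸ I)ˣ →* Rˣ} (hχ : χ ≠ 1) :
    ∑ c, (χ c : R) = 0 := by
  obtain ⟨c₀, hc₀⟩ := DFunLike.exists_ne hχ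
  have hunit : IsUnit ((χ c₀ : R) - 1) := by
    refine isUnit_of_notMem (I := I) fun hmem => hc₀ ?_
    exact eq_one_of_red_eq_one_of_pow_eq_one (natCast_card_residue_units_notMem I)
      (red_eq_one_iff.2 (mem_oneAdd.2 (by rwa [pow_one]))) (hom_pow_card χ c₀)
  have htranslate : (χ c₀ : R) * ∑ c, (χ c : R) = ∑ c, (χ c : R) := by
    rw [Finset.mul_sum]
    refine Fintype.sum_equiv (Equiv.mulLeft c₀) _ _ fun c => ?_
    rw [Equiv.coe_mulLeft, map_mul, Units.val_mul]
  refine hunit.mul_right_eq_zero.1 ?_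
  rw [sub_mul, htranslate, one_mul, sub_self]

variable (I) in
theorem card_residue_units_le_card_chars :
    Nat.card (R ⧸ I)ˣ ≤ Nat.card ((R ⧸ I)ˣ →* Rˣ) := by
  let _ := Ideal.Quotient.field I
  obtain ⟨g, hg⟩ := IsCyclic.exists_generator (α := (R ⧸ I)ˣ)
  have hord := orderOf_eq_card_of_forall_mem_zpowers hg
  have hinj : Function.Injective fun k : Fin (Nat.card (R ⧸ I)ˣ) =>
      (teichmuller I).comp (powMonoidHom (k : ℕ)) := by
    intro k l hkl
    have hteich : teichmuller I (g ^ (k : ℕ)) = teichmuller I (g ^ (l : ℕ)) :=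
      DFunLike.congr_fun hkl g
    have hpow : g ^ (k : ℕ) = g ^ (l : ℕ) :=
      (Function.LeftInverse.injective red_teichmuller) hteich
    exact Fin.ext (pow_injOn_Iio_orderOf (k.2.trans_eq hord.symm) (l.2.trans_eq hord.symm) hpow)
  simpa only [Nat.card_fin] using Nat.card_le_card_of_injective _ hinj

end Characters

section Level

variable {R : Type*} [CommRing R] {I : Ideal R}
variable {G : Type*} [CommGroup G] (N : ℕ →o (Subgroup G)ᵒᵈ)

variable {N} in
theorem level_algHom_ext {m : ℕ} {B : Type*} [CommRing B] [Algebra R B]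
    {φ ψ : Level I N m →ₐ[R] B}
    (h : ∀ g : G, φ (MonoidAlgebra.single (QuotientGroup.mk g) 1) =
      ψ (MonoidAlgebra.single (QuotientGroup.mk g) 1)) : φ = ψ :=
  MonoidAlgebra.algHom_ext (QuotientGroup.mk_surjective.forall.2 h)
    (Ideal.Quotient.algHom_ext _ (by ext))

variable (I) in
theorem subsingleton_level_zero : Subsingleton (Level I N 0) := by
  refine subsingleton_of_zero_eq_one ?_
  rw [← map_one (algebraMap R (Level I N 0)),
    algebraMap_level_eq_zero I N (by rw [pow_zero, Ideal.one_eq_top]; exact Submodule.mem_top)]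

end Level

section Decomposition

variable {R : Type*} [CommRing R] {I : Ideal R}

theorem red_mul_coe (ζ : Rˣ) (v : oneAdd I 1) : red I (ζ * v) = red I ζ := by
  rw [map_mul, red_eq_one_iff.2 v.2, mul_one]

/-- The inclusion of the `m`-th level of `R⟦1 + I⟧` into the `m`-th level of `R⟦Rˣ⟧`. -/
def levelIncl (m : ℕ) : Level I (oneUnitFiltration I) m →ₐ[R] Level I (unitFiltration I) m :=
  MonoidAlgebra.mapDomainAlgHom R (R ⧸ I ^ m)
    (QuotientGroup.map (sub (oneUnitFiltration I) m) (sub (unitFiltration I) m)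
      (oneAdd I 1).subtype fun _ hu => hu)

theorem levelIncl_single (m : ℕ) (v : oneAdd I 1) :
    levelIncl m (MonoidAlgebra.single (QuotientGroup.mk v) 1) =
    MonoidAlgebra.single (QuotientGroup.mk (v : Rˣ) : Rˣ ⧸ sub (unitFiltration I) m) 1 :=
  MonoidAlgebra.mapDomain_single

variable [I.IsMaximal] [IsAdicComplete I R] [Finite (R ⧸ I)]

variable (I) in
/-- The projection `u ↦ u / τ(u mod I)` of `Rˣ` onto `1 + I`, for the Teichmüller character
`τ`. -/
def onePart : Rˣ →* oneAdd I 1 :=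
  (MonoidHom.id Rˣ / (teichmuller I).comp (red I)).codRestrict (oneAdd I 1) fun u => by
    rw [← red_eq_one_iff, MonoidHom.div_apply, _root_.map_div, MonoidHom.comp_apply,
      red_teichmuller, MonoidHom.id_apply, div_self']

theorem coe_onePart (u : Rˣ) : (onePart I u : Rˣ) = u / teichmuller I (red I u) := rfl

theorem onePart_mem {m : ℕ} (hm : m ≠ 0) {u : Rˣ} (hu : u ∈ oneAdd I m) :
    onePart I u ∈ sub (oneUnitFiltration I) m := by
  change (onePart I u : Rˣ) ∈ oneAdd I m
  have hred : red I u = 1 := red_eq_one_iff.2 (oneAdd_anti I (Nat.one_le_iff_ne_zero.2 hm) hu)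
  rwa [coe_onePart, hred, map_one, div_one]

theorem onePart_coe (v : oneAdd I 1) : onePart I v = v :=
  Subtype.ext (by rw [coe_onePart, red_eq_one_iff.2 v.2, map_one, div_one])

theorem onePart_teichmuller (c : (R ⧸ I)ˣ) : onePart I (teichmuller I c) = 1 :=
  Subtype.ext (by rw [coe_onePart, red_teichmuller, div_self', Subgroup.coe_one])

theorem onePart_mul_coe {ζ : Rˣ} (hζ : ζ ^ Nat.card (R ⧸ I)ˣ = 1) (v : oneAdd I 1) :
    onePart I (ζ * v) = v :=
  Subtype.ext (by rw [coe_onePart, red_mul_coe, teichmuller_red hζ, mul_div_cancel_left])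

/-- The homomorphism `u ↦ χ(u mod I) [u / τ(u mod I)]` to the units of the `m`-th level. -/
def charHom (χ : (R ⧸ I)ˣ →* Rˣ) (m : ℕ) :
    Rˣ ⧸ sub (unitFiltration I) m →* Level I (oneUnitFiltration I) m :=
  QuotientGroup.lift _
    (((algebraMap R (Level I (oneUnitFiltration I) m) : R →* _).comp
        ((Units.coeHom R).comp (χ.comp (red I)))) *
      ((MonoidAlgebra.of (R ⧸ I ^ m) (oneAdd I 1 ⧸ sub (oneUnitFiltration I) m)).comp
        ((QuotientGroup.mk' _).comp (onePart I))))
    (by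
      intro u hu
      rcases eq_or_ne m 0 with rfl | hm
      · have := subsingleton_level_zero I (oneUnitFiltration I)
        exact Subsingleton.elim _ _
      · have hred : red I u = 1 :=
          red_eq_one_iff.2 (oneAdd_anti I (Nat.one_le_iff_ne_zero.2 hm) hu)
        have hone : QuotientGroup.mk' (sub (oneUnitFiltration I) m) (onePart I u) = 1 :=
          (QuotientGroup.eq_one_iff _).2 (onePart_mem hm hu)
        rw [MonoidHom.mem_ker, MonoidHom.mul_apply]
        simp only [MonoidHom.comp_apply, hred, hone, map_one, mul_one])

/-- The algebra homomorphism `[u] ↦ χ(u mod I) [u / τ(u mod I)]` between the `m`-th levels of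
`R⟦Rˣ⟧` and `R⟦1 + I⟧`. -/
def levelChar (χ : (R ⧸ I)ˣ →* Rˣ) (m : ℕ) :
    Level I (unitFiltration I) m →ₐ[R] Level I (oneUnitFiltration I) m :=
  (MonoidAlgebra.lift (R ⧸ I ^ m) _ _ (charHom χ m)).restrictScalars R

theorem levelChar_single (χ : (R ⧸ I)ˣ →* Rˣ) (m : ℕ) (u : Rˣ) :
    levelChar χ m (MonoidAlgebra.single (QuotientGroup.mk u) 1) =
    (χ (red I u) : R) • MonoidAlgebra.single (QuotientGroup.mk (onePart I u)) 1 := by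
  rw [levelChar, AlgHom.restrictScalars_apply, MonoidAlgebra.lift_single, one_smul,
    Algebra.smul_def]
  rfl

theorem transition_levelChar (χ : (R ⧸ I)ˣ →* Rˣ) (m : ℕ)
    (x : Level I (unitFiltration I) (m + 1)) :
    transition I _ m (levelChar χ (m + 1) x) = levelChar χ m (transition I _ m x) := by
  suffices (transition I _ m).comp (levelChar χ (m + 1)) =
      (levelChar χ m).comp (transition I _ m) from DFunLike.congr_fun this x
  refine level_algHom_ext fun u => ?_
  simp only [AlgHom.comp_apply, levelChar_single, map_smul, transition_single_one]

theorem levelChar_levelIncl (χ : (R ⧸ I)ˣ →* Rˣ) (m : ℕ) (x : Level I (oneUnitFiltration I) m) :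
    levelChar χ m (levelIncl m x) = x := by
  suffices (levelChar χ m).comp (levelIncl m) = AlgHom.id R _ from DFunLike.congr_fun this x
  refine level_algHom_ext fun v => ?_
  rw [AlgHom.comp_apply, levelIncl_single, levelChar_single, red_eq_one_iff.2 v.2, map_one,
    Units.val_one, one_smul, onePart_coe, AlgHom.id_apply]

theorem card_quot_unitFiltration_le [∀ m, Finite (R ⧸ I ^ m)] (m : ℕ) :
    Nat.card (Rˣ ⧸ sub (unitFiltration I) m) ≤
    Nat.card (R ⧸ I)ˣ * Nat.card (oneAdd I 1 ⧸ sub (oneUnitFiltration I) m) := by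
  rw [← Nat.card_prod]
  refine Nat.card_le_card_of_injective (fun y => (red I y.out,
    (QuotientGroup.mk (onePart I y.out) : oneAdd I 1 ⧸ sub (oneUnitFiltration I) m)))
    fun y z hyz => ?_
  obtain ⟨hred, hone⟩ := Prod.ext_iff.1 hyz
  dsimp only at hred hone
  have hmem : (onePart I y.out : Rˣ)⁻¹ * (onePart I z.out : Rˣ) ∈ oneAdd I m :=
    (QuotientGroup.eq (s := sub (oneUnitFiltration I) m)).1 hone
  rw [coe_onePart, coe_onePart, hred, inv_div, div_mul_div_cancel', ← inv_mul_eq_div] at hmem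
  rw [← QuotientGroup.out_eq' y, ← QuotientGroup.out_eq' z, QuotientGroup.eq]
  exact hmem

/-- The idempotent `e_χ = N⁻¹ ∑_c χ(c)⁻¹ [τ(c)]` of the `m`-th level, where `N = #(R/I)ˣ` is a unit
of `R`. -/
def charIdempotent (χ : (R ⧸ I)ˣ →* Rˣ) (m : ℕ) : Level I (unitFiltration I) m :=
  Ring.inverse (Nat.card (R ⧸ I)ˣ : R) • ∑ᶠ c, (χ⁻¹ c : R) •
    MonoidAlgebra.single (QuotientGroup.mk (teichmuller I c)) 1

theorem levelChar_charIdempotent [Fintype (R ⧸ I)ˣ] (χ χ' : (R ⧸ I)ˣ →* Rˣ) (m : ℕ) :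
    levelChar χ m (charIdempotent χ' m) =
    (Ring.inverse (Nat.card (R ⧸ I)ˣ : R) * ∑ c, ((χ / χ') c : R)) • 1 := by
  have hterm (c : (R ⧸ I)ˣ) : levelChar χ m ((χ'⁻¹ c : R) •
      MonoidAlgebra.single (QuotientGroup.mk (teichmuller I c)) 1) = ((χ / χ') c : R) • 1 := by
    rw [map_smul, levelChar_single, red_teichmuller, onePart_teichmuller, smul_smul,
      QuotientGroup.mk_one, ← MonoidAlgebra.one_def, ← Units.val_mul, MonoidHom.inv_apply,
      MonoidHom.div_apply, div_eq_inv_mul]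
  rw [charIdempotent, finsum_eq_sum_of_fintype, map_smul, map_sum, mul_smul, Finset.sum_smul]
  exact congrArg _ (Finset.sum_congr rfl fun c _ => hterm c)

theorem levelChar_charIdempotent_self (χ : (R ⧸ I)ˣ →* Rˣ) (m : ℕ) :
    levelChar χ m (charIdempotent χ m) = 1 := by
  have := Fintype.ofFinite (R ⧸ I)ˣ
  have hunit := isUnit_of_notMem (natCast_card_residue_units_notMem I)
  have hsum : ∑ c, ((χ / χ) c : R) = Nat.card (R ⧸ I)ˣ := by
    simp [Nat.card_eq_fintype_card]
  rw [levelChar_charIdempotent, hsum, Ring.inverse_mul_cancel _ hunit, one_smul]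

theorem levelChar_charIdempotent_of_ne {χ χ' : (R ⧸ I)ˣ →* Rˣ} (h : χ ≠ χ') (m : ℕ) :
    levelChar χ m (charIdempotent χ' m) = 0 := by
  have := Fintype.ofFinite (R ⧸ I)ˣ
  rw [levelChar_charIdempotent, sum_char_eq_zero (div_ne_one.2 h), mul_zero, zero_smul]

theorem levelChar_surjective (m : ℕ) :
    Function.Surjective fun (x : Level I (unitFiltration I) m) χ => levelChar χ m x := by
  have := Fintype.ofFinite ((R ⧸ I)ˣ →* Rˣ)
  intro y
  refine ⟨∑ χ, levelIncl m (y χ) * charIdempotent χ m, funext fun χ => ?_⟩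
  simp only [map_sum, map_mul, levelChar_levelIncl]
  rw [Fintype.sum_eq_single χ fun χ' hχ' => by
      rw [levelChar_charIdempotent_of_ne hχ'.symm, mul_zero],
    levelChar_charIdempotent_self, mul_one]

variable (I) in
/-- The algebra homomorphism `[u] ↦ χ(u mod I) [u / τ(u mod I)]` from `R⟦Rˣ⟧` to `R⟦1 + I⟧`. -/
def charProj (χ : (R ⧸ I)ˣ →* Rˣ) : Alg I (unitFiltration I) →ₐ[R] Alg I (oneUnitFiltration I) :=
  limLift I _ (fun m => (levelChar χ m).comp (proj I _ m)) fun m x => by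
    rw [AlgHom.comp_apply, transition_levelChar, transition_proj, AlgHom.comp_apply]

theorem proj_charProj (χ : (R ⧸ I)ˣ →* Rˣ) (m : ℕ) (x : Alg I (unitFiltration I)) :
    proj I _ m (charProj I χ x) = levelChar χ m (proj I _ m x) :=
  proj_limLift I _ _ _ m x

theorem continuous_charProj (χ : (R ⧸ I)ˣ →* Rˣ) : Continuous (charProj I χ) := by
  refine continuous_of_preimage_ker_proj_mem_nhds (charProj I χ).toRingHom fun m => ?_
  refine Filter.mem_of_superset ((nhds_zero_hasBasis I _).mem_of_mem (i := m) trivial)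
    fun x hx => ?_
  exact (proj_charProj χ m x).trans ((congrArg _ hx).trans (map_zero _))

theorem charProj_of_mul_coe (χ : (R ⧸ I)ˣ →* Rˣ) {ζ : Rˣ} (hζ : ζ ^ Nat.card (R ⧸ I)ˣ = 1)
    (v : oneAdd I 1) :
    charProj I χ (of I (unitFiltration I) (ζ * v)) =
    (χ (red I ζ) : R) • of I (oneUnitFiltration I) v := by
  refine alg_ext fun m => ?_
  rw [proj_charProj, proj_of, levelChar_single, red_mul_coe, onePart_mul_coe hζ, map_smul, proj_of]

variable [∀ m, Finite (R ⧸ I ^ m)]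

theorem levelChar_bijective (m : ℕ) :
    Function.Bijective fun (x : Level I (unitFiltration I) m) χ => levelChar χ m x := by
  refine (levelChar_surjective m).bijective_of_nat_card_le ?_
  rw [Nat.card_fun, nat_card_level, nat_card_level, ← pow_mul, mul_comm]
  refine Nat.pow_le_pow_right Nat.card_pos ((card_quot_unitFiltration_le m).trans ?_)
  exact Nat.mul_le_mul_right _ (card_residue_units_le_card_chars I)

theorem pi_charProj_bijective : Function.Bijective (AlgHom.pi (charProj I)) := by
  constructor
  · intro x y hxy
    refine alg_ext fun m => (levelChar_bijective m).1 (funext fun χ => ?_)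
    exact congrArg (proj I _ m) (congrFun hxy χ)
  · intro y
    choose x hx using fun m => (levelChar_bijective m).2 fun χ => proj I _ m (y χ)
    have hcompat (m : ℕ) : transition I _ m (x (m + 1)) = x m := by
      refine (levelChar_bijective m).1 (funext fun χ => ?_)
      have hsucc : levelChar χ (m + 1) (x (m + 1)) = _ := congrFun (hx (m + 1)) χ
      have hm : levelChar χ m (x m) = _ := congrFun (hx m) χ
      exact (transition_levelChar χ m _).symm.trans <|
        (congrArg _ hsucc).trans <| (transition_proj I _ m _).trans hm.symm
    exact ⟨⟨x, hcompat⟩, funext fun χ => alg_ext fun m => congrFun (hx m) χ⟩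

variable (I) in
theorem exists_algEquiv_pi :
    ∃ e : Alg I (unitFiltration I) ≃ₐ[R] (((R ⧸ I)ˣ →* Rˣ) → Alg I (oneUnitFiltration I)),
      Continuous e ∧ Continuous e.symm ∧
      ∀ (ζ : Rˣ) (v : oneAdd I 1) (χ : (R ⧸ I)ˣ →* Rˣ), ζ ^ Nat.card (R ⧸ I)ˣ = 1 →
        e (of I (unitFiltration I) (ζ * (v : Rˣ))) χ =
          (χ (red I ζ) : R) • of I (oneUnitFiltration I) v := by
  let e := AlgEquiv.ofBijective (AlgHom.pi (charProj I)) pi_charProj_bijective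
  have hcont : Continuous e := continuous_pi continuous_charProj
  have := (alg_isProfiniteRing I (unitFiltration I)).compactSpace
  refine ⟨e, hcont, ?_, fun ζ v χ hζ => charProj_of_mul_coe χ hζ v⟩
  exact (Continuous.homeoOfEquivCompactToT2 (f := e.toEquiv) hcont).symm.continuous

end Decomposition

section Filtration

variable {S : Type*} [CommRing S]

theorem exists_pow_le_of_le_jacobson {M J : Ideal S} [IsArtinianRing (S ⧸ J)]
    (hM : M ≤ Ideal.jacobson ⊥) : ∃ k, M ^ k ≤ J := by
  obtain ⟨k, hk⟩ := IsArtinianRing.isNilpotent_jacobson_bot (R := S ⧸ J)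
  have hle : M.map (Ideal.Quotient.mk J) ≤ Ideal.jacobson ⊥ := by
    rw [Ideal.jacobson_bot] at hM ⊢
    exact Ideal.map_le_iff_le_comap.2 (hM.trans (Ring.le_comap_jacobson _))
  refine ⟨k, ?_⟩
  have hpow := Ideal.pow_right_mono hle k
  rwa [hk, ← Ideal.map_pow, Ideal.zero_eq_bot, le_bot_iff, Ideal.map_eq_bot_iff_le_ker,
    Ideal.mk_ker] at hpow

theorem finite_maximalSpectrum_of_le_jacobson {M : Ideal S} [IsArtinianRing (S ⧸ M)]
    (hM : M ≤ Ideal.jacobson ⊥) : Finite (MaximalSpectrum S) := by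
  have hker (P : MaximalSpectrum S) : RingHom.ker (Ideal.Quotient.mk M) ≤ P.asIdeal :=
    Ideal.mk_ker.trans_le (hM.trans (sInf_le ⟨bot_le, P.isMaximal⟩))
  let toQuotient (P : MaximalSpectrum S) : MaximalSpectrum (S ⧸ M) :=
    have := P.isMaximal
    ⟨P.asIdeal.map (Ideal.Quotient.mk M),
      Ideal.IsMaximal.map_of_surjective_of_ker_le Ideal.Quotient.mk_surjective (hker P)⟩
  have hcomap (P : MaximalSpectrum S) :
      (toQuotient P).asIdeal.comap (Ideal.Quotient.mk M) = P.asIdeal := by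
    rw [Ideal.comap_map_of_surjective' _ Ideal.Quotient.mk_surjective, sup_eq_left.2 (hker P)]
  refine Finite.of_injective toQuotient fun P Q hPQ => MaximalSpectrum.ext ?_
  rw [← hcomap P, hPQ, hcomap Q]

theorem quotActsThrough_of_ker_mul_le {B : Type*} [CommRing B] {π : S →+* B}
    (hπ : Function.Surjective π) {J J' : Ideal S} (h : RingHom.ker π * J ≤ J') :
    QuotActsThrough π J J' := by
  let action : S →+* Module.End S (J ⧸ J'.submoduleOf J) := algebraMap S _
  have hker : RingHom.ker π ≤ RingHom.ker action := by
    intro x hx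
    refine LinearMap.ext fun v => ?_
    obtain ⟨v, rfl⟩ := Submodule.Quotient.mk_surjective _ v
    exact (Submodule.Quotient.mk_eq_zero _).2 (h (Ideal.mul_mem_mul hx v.2))
  exact ⟨RingHom.liftOfSurjective π hπ ⟨action, hker⟩, fun x v =>
    LinearMap.congr_fun (RingHom.liftOfSurjective_comp_apply π hπ ⟨action, hker⟩ x) v⟩

/-- The ideal `⋂_m (M ^ (1 + (r - m)) + M ∩ J_m)`, with truncated subtraction `r - m`. For fixed
`m` the `r`-th term is a power of `M` modulo `J_m` which starts to grow only at `r = m`; this delay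
makes the intersection over all `m` open. -/
def filtrationIdeal (M : Ideal S) (J : ℕ → Ideal S) (r : ℕ) : Ideal S :=
  ⨅ m, M ^ (1 + (r - m)) ⊔ M ⊓ J m

variable (M : Ideal S) (J : ℕ → Ideal S)

theorem filtrationIdeal_antitone : Antitone (filtrationIdeal M J) := fun _ _ hrs =>
  iInf_mono fun _ => sup_le_sup_right (Ideal.pow_le_pow_right (by omega)) _

theorem filtrationIdeal_zero : filtrationIdeal M J 0 = M := by
  simp only [filtrationIdeal, Nat.zero_sub, add_zero, pow_one,
    sup_eq_left.2 (inf_le_left : M ⊓ _ ≤ M), iInf_const]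

theorem mul_filtrationIdeal_le (r : ℕ) :
    M * filtrationIdeal M J r ≤ filtrationIdeal M J (r + 1) := by
  refine le_iInf fun m => (Ideal.mul_mono_right (iInf_le _ m)).trans ?_
  rw [Ideal.mul_sup, ← pow_succ']
  exact sup_le_sup (Ideal.pow_le_pow_right (by omega)) Ideal.mul_le_right

variable {M J}

theorem inf_le_filtrationIdeal (hJ : Antitone J) (r : ℕ) : M ⊓ J r ≤ filtrationIdeal M J r := by
  refine le_iInf fun m => ?_
  rcases le_total m r with hmr | hrm
  · exact (inf_le_inf_left M (hJ hmr)).trans le_sup_right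
  · rw [Nat.sub_eq_zero_of_le hrm, add_zero, pow_one]
    exact inf_le_left.trans le_sup_left

theorem filtrationIdeal_add_le {m k : ℕ} (hk : M ^ k ≤ J m) :
    filtrationIdeal M J (m + k) ≤ J m := by
  refine (iInf_le _ m).trans (sup_le ((Ideal.pow_le_pow_right ?_).trans hk) inf_le_right)
  omega

variable [TopologicalSpace S]

theorem filtrationIdeal_mem_nhds (hJ : Antitone J) (hJo : ∀ m, (J m : Set S) ∈ 𝓝 0)
    (hM : (M : Set S) ∈ 𝓝 0) (r : ℕ) : (filtrationIdeal M J r : Set S) ∈ 𝓝 0 :=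
  Filter.mem_of_superset (Filter.inter_mem hM (hJo r)) (inf_le_filtrationIdeal hJ r)

theorem nhds_zero_hasBasis_filtrationIdeal (hJ : Antitone J)
    (hbasis : (𝓝 (0 : S)).HasBasis (fun _ : ℕ => True) fun m => (J m : Set S))
    [∀ m, IsArtinianRing (S ⧸ J m)] (hM : (M : Set S) ∈ 𝓝 0) (hjac : M ≤ Ideal.jacobson ⊥) :
    (𝓝 (0 : S)).HasBasis (fun _ : ℕ => True) fun r => (filtrationIdeal M J r : Set S) := by
  refine hbasis.to_hasBasis (fun m _ => ?_) fun r _ => ?_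
  · obtain ⟨k, hk⟩ := exists_pow_le_of_le_jacobson (J := J m) hjac
    exact ⟨m + k, trivial, filtrationIdeal_add_le hk⟩
  · exact hbasis.mem_iff.1
      (filtrationIdeal_mem_nhds hJ (fun m => hbasis.mem_of_mem trivial) hM r)

theorem finite_quotient_of_mem_nhds {K : Ideal S} (hK : (K : Set S) ∈ 𝓝 0)
    (hbasis : (𝓝 (0 : S)).HasBasis (fun _ : ℕ => True) fun m => (J m : Set S))
    [∀ m, Finite (S ⧸ J m)] : Finite (S ⧸ K) := by
  obtain ⟨m, -, hm⟩ := hbasis.mem_iff.1 hK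
  exact Finite.of_surjective _ (Ideal.Quotient.factor_surjective (SetLike.coe_subset_coe.1 hm))

theorem exists_filtration (hJ : Antitone J)
    (hbasis : (𝓝 (0 : S)).HasBasis (fun _ : ℕ => True) fun m => (J m : Set S))
    [∀ m, Finite (S ⧸ J m)] {B : Type*} [CommRing B] {π : S →+* B}
    (hπ : Function.Surjective π) (hker : (RingHom.ker π : Set S) ∈ 𝓝 0)
    (hjac : RingHom.ker π ≤ Ideal.jacobson ⊥) :
    ∃ K : ℕ → Ideal S, Antitone K ∧
      (𝓝 (0 : S)).HasBasis (fun _ : ℕ => True) (fun r => (K r : Set S)) ∧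
      (∀ r, Finite (S ⧸ K r)) ∧ K 0 = RingHom.ker π ∧
      ∀ r, QuotActsThrough π (K r) (K (r + 1)) := by
  have hK := nhds_zero_hasBasis_filtrationIdeal hJ hbasis hker hjac
  exact ⟨filtrationIdeal (RingHom.ker π) J, filtrationIdeal_antitone _ _, hK,
    fun r => finite_quotient_of_mem_nhds (hK.mem_of_mem trivial) hbasis,
    filtrationIdeal_zero _ _,
    fun r => quotActsThrough_of_ker_mul_le hπ (mul_filtrationIdeal_le _ _ r)⟩

end Filtration

section Residue

variable {R : Type*} [CommRing R] {I : Ideal R}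
variable {G : Type*} [CommGroup G] {N : ℕ →o (Subgroup G)ᵒᵈ}
variable {S : Type*} [CommRing S] [Algebra R S] {ι : Type*}

/-- The ring homomorphism `S → ∏_i R/I` obtained from a decomposition `S ≅ ∏_i R⟦G⟧` by reducing
every component. -/
def residuePi (e : S ≃ₐ[R] (ι → Alg I N)) : S →+* (ι → R ⧸ I) :=
  RingHom.pi fun i =>
    ((residue I N : Alg I N →+* R ⧸ I).comp (Pi.evalRingHom (fun _ => Alg I N) i)).comp
      (e : S →+* (ι → Alg I N))

theorem residuePi_surjective (e : S ≃ₐ[R] (ι → Alg I N)) :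
    Function.Surjective (residuePi e) := by
  intro y
  choose x hx using fun i => residue_surjective I N (y i)
  refine ⟨e.symm x, funext fun i => ?_⟩
  change residue I N (e (e.symm x) i) = y i
  rw [e.apply_symm_apply, hx]

theorem mem_ker_residuePi {e : S ≃ₐ[R] (ι → Alg I N)} {x : S} :
    x ∈ RingHom.ker (residuePi e) ↔ ∀ i, residue I N (e x i) = 0 :=
  funext_iff

theorem isUnit_of_residue_eq_one [I.IsMaximal] [IsLocalRing (Alg I N)] {x : Alg I N}
    (hx : residue I N x = 1) : IsUnit x := by
  rw [← IsLocalRing.notMem_maximalIdeal,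
    ← IsLocalRing.eq_maximalIdeal (ker_residue_isMaximal I N), RingHom.mem_ker, hx]
  exact one_ne_zero

theorem ker_residuePi_le_jacobson [I.IsMaximal] [IsLocalRing (Alg I N)]
    (e : S ≃ₐ[R] (ι → Alg I N)) : RingHom.ker (residuePi e) ≤ Ideal.jacobson ⊥ := by
  intro x hx
  rw [mem_ker_residuePi] at hx
  refine Ideal.mem_jacobson_bot.2 fun y => ?_
  rw [← isUnit_map_iff e, Pi.isUnit_iff]
  refine fun i => isUnit_of_residue_eq_one ?_
  rw [map_add, map_mul, map_one, Pi.add_apply, Pi.mul_apply, Pi.one_apply, map_add, map_mul, hx,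
    zero_mul, zero_add, map_one]

theorem ker_residuePi_mem_nhds [TopologicalSpace S] [Finite ι] {e : S ≃ₐ[R] (ι → Alg I N)}
    (he : Continuous e) : (RingHom.ker (residuePi e) : Set S) ∈ 𝓝 0 := by
  have hresidue : ∀ᶠ y in 𝓝 (0 : Alg I N), residue I N y = 0 :=
    Filter.mem_of_superset ((nhds_zero_hasBasis I N).mem_of_mem (i := 1) trivial)
      (ker_proj_le_ker_residue I N)
  have hcomp (i : ι) : ∀ᶠ x in 𝓝 (0 : S), residue I N (e x i) = 0 :=
    (((continuous_apply i).comp he).tendsto' 0 0 (congrFun (map_zero e) i)).eventually hresidue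
  exact Filter.mem_of_superset (Filter.eventually_all.2 hcomp) fun x hx => mem_ker_residuePi.2 hx

instance finite_quotient_ker_proj [∀ m, Finite (R ⧸ I ^ m)] [∀ m, Finite (G ⧸ sub N m)] (m : ℕ) :
    Finite (Alg I N ⧸ RingHom.ker (proj I N m)) :=
  Finite.of_injective _ (RingHom.kerLift_injective _)

end Residue

section Completion

open Polynomial

variable {F : Type*} [Field F] (ϖ : F[X])

theorem pp_eq_span : pp ϖ = Ideal.span {algebraMap F[X] (Ap ϖ) ϖ} := by
  rw [pp, Ideal.map_span, Set.image_singleton]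

instance isAdicComplete_pp : IsAdicComplete (pp ϖ) (Ap ϖ) :=
  AdicCompletion.isAdicComplete_self _ (Submodule.fg_span_singleton ϖ)

variable {ϖ}

theorem isMaximal_pp (hirr : Irreducible ϖ) : (pp ϖ).IsMaximal :=
  have := PrincipalIdealRing.isMaximal_of_irreducible hirr
  AdicCompletion.isMaximal_map_of_le _ _ le_rfl (Submodule.fg_span_singleton ϖ)

theorem finite_kappa [Finite F] (hmonic : ϖ.Monic) : Finite (Kappa ϖ) := by
  have := hmonic.finite_quotient
  have := Module.finite_of_finite F (M := F[X] ⧸ Ideal.span {ϖ})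
  have hker : RingHom.ker (AdicCompletion.evalOneₐ (Ideal.span {ϖ})).toRingHom = pp ϖ :=
    AdicCompletion.ker_evalOneₐ_eq_map _ (Submodule.fg_span_singleton ϖ)
  rw [Kappa, ← hker]
  exact Finite.of_injective _ (RingHom.kerLift_injective _)

theorem algebraMap_ap_injective (hirr : Irreducible ϖ) :
    Function.Injective (algebraMap F[X] (Ap ϖ)) :=
  have := IsHausdorff.of_isDomain (Ideal.span {ϖ})
    (PrincipalIdealRing.isMaximal_of_irreducible hirr).ne_top
  AdicCompletion.of_injective (Ideal.span {ϖ}) F[X]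

theorem not_isNilpotent_algebraMap (hirr : Irreducible ϖ) :
    ¬ IsNilpotent (algebraMap F[X] (Ap ϖ) ϖ) := by
  rw [IsNilpotent.map_iff (algebraMap_ap_injective hirr), isNilpotent_iff_eq_zero]
  exact hirr.ne_zero

theorem charP_ap (hirr : Irreducible ϖ) (p : ℕ) [CharP F p] : CharP (Ap ϖ) p :=
  charP_of_injective_algebraMap (algebraMap_ap_injective hirr) p

end Completion

end Iwasawa

end

open Topology Iwasawa MvPowerSeries.WithPiTopology in
theorem mainTheorem9_general {R : Type*} [CommRing R] [TopologicalSpace R] {I : Ideal R}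
    [I.IsMaximal] [IsAdicComplete I R] [Finite (R ⧸ I)] (hadic : IsAdic I) {t : R}
    (hI : I = Ideal.span {t}) (ht : ¬ IsNilpotent t) (p : ℕ) [Fact p.Prime] [CharP R p] :
    IsProfiniteRing (Alg I (unitFiltration I)) ∧
    Finite (MaximalSpectrum (Alg I (unitFiltration I))) ∧
    IsProfiniteRing (Alg I (oneUnitFiltration I)) ∧
    IsLocalRing (Alg I (oneUnitFiltration I)) ∧
    Function.Surjective (residue I (oneUnitFiltration I)) ∧
    (RingHom.ker (residue I (oneUnitFiltration I))).IsMaximal ∧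
    (∃ f : Alg I (oneUnitFiltration I) ≃ₐ[R] MvPowerSeries ℕ R,
      Continuous f ∧ Continuous f.symm) ∧
    ∃ e : Alg I (unitFiltration I) ≃ₐ[R] (((R ⧸ I)ˣ →* Rˣ) → Alg I (oneUnitFiltration I)),
      Continuous e ∧ Continuous e.symm ∧
      (∀ (ζ : Rˣ) (v : oneAdd I 1) (χ : (R ⧸ I)ˣ →* Rˣ), ζ ^ Nat.card (R ⧸ I)ˣ = 1 →
        e (of I (unitFiltration I) (ζ * (v : Rˣ))) χ =
          (χ (red I ζ) : R) • of I (oneUnitFiltration I) v) ∧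
      ∃ K : ℕ → Ideal (Alg I (unitFiltration I)), Antitone K ∧
        (𝓝 (0 : Alg I (unitFiltration I))).HasBasis (fun _ : ℕ => True)
          (fun r => (K r : Set (Alg I (unitFiltration I)))) ∧
        (∀ r, Finite (Alg I (unitFiltration I) ⧸ K r)) ∧
        K 0 = RingHom.ker (residuePi e) ∧
        ∀ r, QuotActsThrough (residuePi e) (K r) (K (r + 1)) := by
  have (m : ℕ) : Finite (R ⧸ I ^ m) := Ideal.finite_quotient_pow (hI ▸ ⟨{t}, by simp⟩) m
  have : IsLocalRing R := isLocalRing_of_isAdicComplete_maximal I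
  obtain ⟨f, hf, hf_symm⟩ := exists_oneUnit_algEquiv_mvPowerSeries hadic hI ht p
  have : IsLocalRing (Alg I (oneUnitFiltration I)) := f.symm.toRingEquiv.isLocalRing
  obtain ⟨e, he, he_symm, he_of⟩ := exists_algEquiv_pi I
  have hjac := ker_residuePi_le_jacobson e
  obtain ⟨K, hK, hbasis, hfin, hK_zero, hacts⟩ := exists_filtration
    (ker_proj_antitone I (unitFiltration I)) (nhds_zero_hasBasis _ _)
    (residuePi_surjective e) (ker_residuePi_mem_nhds he) hjac
  have : Finite (Alg I (unitFiltration I) ⧸ RingHom.ker (residuePi e)) := hK_zero ▸ hfin 0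
  exact ⟨alg_isProfiniteRing _ _, finite_maximalSpectrum_of_le_jacobson hjac,
    alg_isProfiniteRing _ _, inferInstance, residue_surjective _ _, ker_residue_isMaximal _ _,
    ⟨f, hf, hf_symm⟩, e, he, he_symm, he_of, K, hK, hbasis, hfin, hK_zero, hacts⟩

open Polynomial Topology Iwasawa MvPowerSeries.WithPiTopology in
theorem mainTheorem9 {F : Type*} [Field F] [Finite F] (ϖ : F[X]) (hmonic : ϖ.Monic)
    (hirr : Irreducible ϖ) :
    -- `Λ` is a profinite semilocal ring
    IsProfiniteRing (Lam ϖ) ∧ Finite (MaximalSpectrum (Lam ϖ)) ∧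
    -- `Λ₀` is a profinite local ring with residue field `κ(𝔭)`
    IsProfiniteRing (Lam0 ϖ) ∧ IsLocalRing (Lam0 ϖ) ∧
    Function.Surjective (residue0 ϖ) ∧ (RingHom.ker (residue0 ϖ)).IsMaximal ∧
    -- `Λ₀ ≅ A_𝔭⟦T₁, T₂, …⟧`
    (∃ f : Lam0 ϖ ≃ₐ[Ap ϖ] MvPowerSeries ℕ (Ap ϖ), Continuous f ∧ Continuous f.symm) ∧
    -- `Λ ≅ ∏_χ Λ₀`, the `χ`-component being `[ζ v] ↦ χ(ζ) [v]`
    ∃ e : Lam ϖ ≃ₐ[Ap ϖ] (Chars ϖ → Lam0 ϖ), Continuous e ∧ Continuous e.symm ∧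
      (∀ (ζ : (Ap ϖ)ˣ) (v : OneUnits ϖ) (χ : Chars ϖ), ζ ^ Nat.card (Kappa ϖ)ˣ = 1 →
        e (ofUnit ϖ (ζ * (v : (Ap ϖ)ˣ))) χ =
          (χ (unitReduction ϖ ζ) : Ap ϖ) • ofOneUnit ϖ v) ∧
      -- the chain of ideals `I_r`, cofinal among the open ideals
      ∃ I : ℕ → Ideal (Lam ϖ), Antitone I ∧
        (𝓝 (0 : Lam ϖ)).HasBasis (fun _ : ℕ => True) (fun r => (I r : Set (Lam ϖ))) ∧
        (∀ r, Finite (Lam ϖ ⧸ I r)) ∧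
        I 0 = RingHom.ker (residueProd ϖ e) ∧
        -- the action of `Λ` on `I_r/I_{r+1}` factors through `Λ → ∏_χ κ(𝔭)`
        ∀ r, QuotActsThrough (residueProd ϖ e) (I r) (I (r + 1)) := by
  obtain ⟨p, _⟩ := CharP.exists F
  have : Fact p.Prime := ⟨CharP.char_is_prime F p⟩
  have := isMaximal_pp hirr
  have := finite_kappa hmonic
  have := charP_ap hirr p
  exact mainTheorem9_general rfl (pp_eq_span ϖ) (not_isNilpotent_algebraMap hirr) p
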